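/- Let $N\ge 0$, let $|\cdot|$ be the Euclidean norm on $\mathbb{R}^N$, and for $\Lambda\subset\{1,\dots,N\}$ let $B_\Lambda=\{x\in\mathbb{R}_+^N : x_i>0 \text{ for } i\in\Lambda,\ x_i=0 \text{ for } i\notin\Lambda\}$. Let $(X(t))_{t\ge 0}$ be a time-homogeneous Markov process, with a transition kernel and with right-continuous paths having left limits, on a state space $E\subset\mathbb{R}_+^N$. For $n\ge 1$ put $Z_n(t)=X(nt)/n$ and $\mathcal{E}_n=\frac1n E$, and for $z\in\mathcal{E}_n$ let $\mathbb{P}_z$ denote the law under which $Z_n(0)=z$, i.e. $X(0)=nz$. Assume that for every $x\in\mathbb{R}_+^N$ there are $x_n\in\mathcal{E}_n$ with $x_n\to x$. In all infima and suprema below $z$ runs over points of $\mathcal{E}_n$, and $\log 0=-\infty$, $\inf\emptyset=+\infty$. Let $L_\Lambda:\mathbb{R}^N\to[0,+\infty]$, $\Lambda\subset\{1,\dots,N\}$, be convex functions such that: (A1) for all $\Lambda\subset\{1,\dots,N\}$ and $S>0$, and every $\phi:[0,S]\to\mathbb{R}_+^N$ with constant velocity $v$ and $\phi(t)\in B_\Lambda$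 for $0<t<S$, $$\lim_{\delta\to0}\lim_{\varepsilon\to0}\liminf_{n\to\infty}\inf_{z:|z-\phi(0)|<\varepsilon}\frac1n\log\mathbb{P}_z\Big(\sup_{t\in[0,S]}|\phi(t)-Z_n(t)|<\delta\Big)\ge -S\,L_\Lambda(v);$$ (A2) $L_{\{1,\dots,N\}}$ is finite in a neighborhood of $0$; (A3) for all $\Lambda\subset\{1,\dots,N\}$, $S>0$ and $x,y\in B_\Lambda$, $$\lim_{\delta\to0}\limsup_{n\to\infty}\sup_{z:|z-x|<\delta}\frac1n\log\mathbb{P}_z\big(|Z_n(S)-y|<\delta \text{ and } \tau_{\Lambda,n}>S\big)\le -S\,L_\Lambda\Big(\frac{y-x}{S}\Big),$$ where $\tau_{\Lambda,n}$ is the hitting time of $\bigcup_{i\in\Lambda}\{x: x_i=0\}$ by $Z_n$. Fix $T>0$ and let $D=D([0,T],\mathbb{R}_+^N)$ be the space of right-continuous functions with left limits, with the Skorohod metric $d_S$. For a continuous piecewise linear $\psi:[0,T]\to\mathbb{R}_+^N$ let $J_{[0,T]}(\psi)=\int_0^T L_{\Lambda(\psi(t))}(\dot\psi(t))\,dt$,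 where $\Lambda(x)=\{i: x_i>0\}$, and for $\phi\in D$ let $$I_{[0,T]}(\phi)=\liminf_{\delta\to0}\ \inf_{\psi}\ J_{[0,T]}(\psi),$$ the infimum being over the continuous piecewise linear $\psi:[0,T]\to\mathbb{R}_+^N$ with $d_S(\phi,\psi)<\delta$. A function $I:D\to[0,+\infty]$ is called a good rate function if (a) for every compact $V\subset\mathbb{R}_+^N$ and every $c>0$ the set $\{\phi\in D:\phi(0)\in V,\ I(\phi)\le c\}$ is compact in $D$, and (b) every $\phi\in D$ with $I(\phi)<\infty$ is absolutely continuous. It satisfies the upper large deviation bound if for all $x\in\mathbb{R}_+^N$ and all closed $F\subset D$ $$\lim_{\varepsilon\to0}\limsup_{n\to\infty}\sup_{z:|z-x|<\varepsilon}\frac1n\log\mathbb{P}_z(Z_n\in F)\le-\inf_{\phi\in F:\,\phi(0)=x}I(\phi),$$ and the lower large deviation bound if for all $x\in\mathbb{R}_+^N$ and all open $O\subset D$ $$\lim_{\varepsilon\to0}\liminf_{n\to\infty}\inf_{z:|z-x|<\varepsilon}\frac1n\log\mathbb{P}_z(Z_n\in O)\ge-\inf_{\phi\in O:\,\phi(0)=x}I(\phi).$$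 Theorem. Suppose that some good rate function $\tilde I_{[0,T]}:D\to[0,+\infty]$ satisfies the upper large deviation bound. Then $(Z_n(t),t\in[0,T])$ satisfies the sample path large deviation principle with rate function $I_{[0,T]}$, that is, $I_{[0,T]}$ is lower semicontinuous and satisfies both the lower and the upper large deviation bound; and $I_{[0,T]}$ is a good rate function. -/

import Mathlib

open Filter Topology MeasureTheory
open scoped NNReal ENNReal

/-- `ℝ^N` with the Euclidean norm. -/
abbrev RN (N : ℕ) : Type := EuclideanSpace ℝ (Fin N)

/-- The closed orthant `ℝ_+^N`. -/
def orthant (N : ℕ) : Set (RN N) := {x | ∀ i, 0 ≤ x i}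

open Classical in
/-- `Λ(x)`, the set of the indices `i` with `x_i > 0`. -/
noncomputable def posSet {N : ℕ} (x : RN N) : Finset (Fin N) :=
  Finset.univ.filter fun i => 0 < x i

/-- `B_Λ`, the set of the `x ∈ ℝ_+^N` with `Λ(x) = Λ`. -/
def face {N : ℕ} (Λ : Finset (Fin N)) : Set (RN N) := {x | x ∈ orthant N ∧ posSet x = Λ}

/-- Right-continuous with left limits. (At a least element the left limit is an empty condition.) -/
def IsCadlag {ι E : Type*} [TopologicalSpace ι] [Preorder ι] [TopologicalSpace E]
    (f : ι → E) : Prop :=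
  (∀ t, ContinuousWithinAt f (Set.Ici t) t) ∧ ∀ t, ∃ l, Tendsto f (𝓝[<] t) (𝓝 l)

/-! ### The Skorohod space -/

/-- `D([0,T], ℝ_+^N)`. -/
structure PathSpace (T : ℝ) (N : ℕ) where
  toFun : Set.Icc (0 : ℝ) T → RN N
  mem_orthant : ∀ t, toFun t ∈ orthant N
  cadlag : IsCadlag toFun

namespace PathSpace

variable {T : ℝ} {N : ℕ}

/-- A path as a function on `ℝ`, with the value `0` outside `[0,T]`. -/
noncomputable def ext (φ : PathSpace T N) (t : ℝ) : RN N :=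
  open Classical in if h : t ∈ Set.Icc (0 : ℝ) T then φ.toFun ⟨t, h⟩ else 0

/-- The Skorohod metric: the infimum over all increasing bijections `θ` of `[0,T]` of the maximum of
`sup_t |θ(t) - t|` and `sup_t |φ(t) - ψ(θ(t))|`. -/
noncomputable def skorohodDist (φ ψ : PathSpace T N) : ℝ≥0∞ :=
  ⨅ θ : Set.Icc (0 : ℝ) T ≃o Set.Icc (0 : ℝ) T,
    max (⨆ t, edist (θ t) t) (⨆ t, edist (φ.toFun t) (ψ.toFun (θ t)))

theorem skorohodDist_self (φ : PathSpace T N) : skorohodDist φ φ = 0 := by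
  refine le_antisymm ?_ bot_le
  refine (iInf_le _ (OrderIso.refl _)).trans ?_
  simp

theorem skorohodDist_comm_le (φ ψ : PathSpace T N) :
    skorohodDist φ ψ ≤ skorohodDist ψ φ := by
  refine le_iInf fun θ => (iInf_le _ θ.symm).trans ?_
  refine max_le_max (iSup_le fun t => ?_) (iSup_le fun t => ?_)
  · refine le_trans (le_of_eq ?_) (le_iSup _ (θ.symm t))
    rw [θ.apply_symm_apply, edist_comm]
  · refine le_trans (le_of_eq ?_) (le_iSup _ (θ.symm t))
    rw [θ.apply_symm_apply, edist_comm]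

theorem skorohodDist_triangle (φ ψ χ : PathSpace T N) :
    skorohodDist φ χ ≤ skorohodDist φ ψ + skorohodDist ψ χ := by
  unfold skorohodDist
  refine ENNReal.le_iInf_add_iInf fun θ η => ?_
  refine (iInf_le _ (θ.trans η)).trans (max_le (iSup_le fun t => ?_) (iSup_le fun t => ?_))
  · calc edist (η (θ t)) t ≤ edist (η (θ t)) (θ t) + edist (θ t) t := edist_triangle _ _ _
      _ = edist (θ t) t + edist (η (θ t)) (θ t) := add_comm _ _
      _ ≤ _ := add_le_add
        ((le_iSup (fun t => edist (θ t) t) t).trans (le_max_left _ _))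
        ((le_iSup (fun t => edist (η t) t) (θ t)).trans (le_max_left _ _))
  · exact (edist_triangle _ (ψ.toFun (θ t)) _).trans (add_le_add
        ((le_iSup (fun t => edist (φ.toFun t) (ψ.toFun (θ t))) t).trans (le_max_right _ _))
        ((le_iSup (fun t => edist (ψ.toFun t) (χ.toFun (η t))) (θ t)).trans (le_max_right _ _)))

/-- The Skorohod space; open, closed and compact sets refer to the topology of this metric. -/
noncomputable instance : PseudoEMetricSpace (PathSpace T N) where
  edist := skorohodDist
  edist_self := skorohodDist_self
  edist_comm φ ψ := le_antisymm (skorohodDist_comm_le φ ψ) (skorohodDist_comm_le ψ φ)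
  edist_triangle := skorohodDist_triangle

/-- Continuous piecewise linear paths: there are `0 = τ_0 ≤ … ≤ τ_n = T` such that the path is
affine on each closed interval `[τ_i, τ_{i+1}]` (hence continuous). -/
def IsPiecewiseLinear (ψ : PathSpace T N) : Prop :=
  ∃ (n : ℕ) (τ : ℕ → ℝ), Monotone τ ∧ τ 0 = 0 ∧ τ n = T ∧
    ∀ i < n, ∃ a v : RN N, ∀ t : Set.Icc (0 : ℝ) T,
      τ i ≤ t → (t : ℝ) ≤ τ (i + 1) → ψ.toFun t = a + (t : ℝ) • v

end PathSpace

/-! ### The rate function -/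

/-- `J(ψ) = ∫_0^T L(ψ(t), ψ'(t)) dt` with `L(x, v) = L_{Λ(x)}(v)`. -/
noncomputable def actionJ {N : ℕ} (L : Finset (Fin N) → RN N → ℝ≥0∞) {T : ℝ}
    (ψ : PathSpace T N) : ℝ≥0∞ :=
  ∫⁻ t in Set.Icc (0 : ℝ) T, L (posSet (ψ.ext t)) (deriv ψ.ext t)

/-- `I_{[0,T]}(φ) = liminf_{δ → 0} inf J(ψ)`, the infimum being taken over the continuous piecewise
linear `ψ` at Skorohod distance less than `δ` from `φ`. -/
noncomputable def rateI {N : ℕ} (L : Finset (Fin N) → RN N → ℝ≥0∞) (T : ℝ)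
    (φ : PathSpace T N) : ℝ≥0∞ :=
  liminf (fun δ : ℝ => ⨅ (ψ : PathSpace T N) (_ : ψ.IsPiecewiseLinear)
    (_ : edist φ ψ < ENNReal.ofReal δ), actionJ L ψ) (𝓝[>] 0)

/-- A good rate function on `D([0,T], ℝ_+^N)`. -/
structure IsGoodRateFunction {T : ℝ} {N : ℕ} (I : PathSpace T N → ℝ≥0∞) : Prop where
  isCompact_level : ∀ V : Set (RN N), V ⊆ orthant N → IsCompact V → ∀ c : ℝ≥0, 0 < c →
    IsCompact {φ : PathSpace T N | φ.ext 0 ∈ V ∧ I φ ≤ c}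
  absolutelyContinuous : ∀ φ : PathSpace T N, I φ < ⊤ → AbsolutelyContinuousOnInterval φ.ext 0 T

/-! ### Markov processes and their rescaling -/

/-- A time-homogeneous Markov process `(X(t))_{t ≥ 0}` on `S ⊆ ℝ_+^N` with càdlàg paths: a family of
laws `P x`, `x ∈ S`, with `X(0) = x` almost surely under `P x`, and a transition kernel for which the
Markov property holds with respect to the natural filtration of `X`. -/
structure MarkovProcess {N : ℕ} (S : Set (RN N)) (Ω : Type*) [MeasurableSpace Ω] where
  subset_orthant : S ⊆ orthant N
  X : ℝ≥0 → Ω → S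
  P : S → Measure Ω
  kernel : ℝ≥0 → ProbabilityTheory.Kernel S S
  isProbabilityMeasure : ∀ x, IsProbabilityMeasure (P x)
  measurable_X : ∀ t, Measurable (X t)
  cadlag : ∀ ω, IsCadlag fun t => (X t ω : RN N)
  start : ∀ x, ∀ᵐ ω ∂(P x), X 0 ω = x
  markov : ∀ (x : S) (s t : ℝ≥0) (A : Set Ω) (B : Set S),
    MeasurableSet[⨆ u : Set.Iic t, MeasurableSpace.comap (X u) inferInstance] A →
    MeasurableSet B →
    P x (A ∩ X (t + s) ⁻¹' B) = ∫⁻ ω in A, kernel s (X t ω) B ∂(P x)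

/-- `𝓔_n = S / n`, for `n ≥ 1`. -/
def scaledStates {N : ℕ} (S : Set (RN N)) (n : ℕ) : Set (RN N) := {z | (n : ℝ) • z ∈ S}

namespace MarkovProcess

variable {N : ℕ} {S : Set (RN N)} {Ω : Type*} [MeasurableSpace Ω]

/-- `Z_n(t) = X(nt) / n`. -/
noncomputable def Z (M : MarkovProcess S Ω) (n : ℕ) (t : ℝ≥0) (ω : Ω) : RN N :=
  (n : ℝ)⁻¹ • (M.X (n * t) ω : RN N)

/-- `P_z`, the law under which `Z_n(0) = z`, where `z ∈ 𝓔_n`: it is the law of `X` started at `n z`. -/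
noncomputable def scaledLaw (M : MarkovProcess S Ω) (n : ℕ) (z : scaledStates S n) : Measure Ω :=
  M.P ⟨(n : ℝ) • (z : RN N), z.2⟩

theorem isCadlag_Z (M : MarkovProcess S Ω) (n : ℕ) (T : ℝ) (ω : Ω) :
    IsCadlag fun t : Set.Icc (0 : ℝ) T => M.Z n (Real.toNNReal t) ω := by
  let g : Set.Icc (0 : ℝ) T → ℝ≥0 := fun t => n * Real.toNNReal t
  have hg : Continuous g := by fun_prop
  have hm : Monotone g := fun a b h => mul_le_mul_right (Real.toNNReal_le_toNNReal h) _
  refine ⟨fun t => ?_, fun t => ?_⟩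
  · have h1 := (M.cadlag ω).1 (g t)
    have h2 : ContinuousWithinAt ((fun s => (M.X s ω : RN N)) ∘ g) (Set.Ici t) t :=
      h1.comp (f := g) (t := Set.Ici (g t)) hg.continuousWithinAt fun s hs => hm hs
    exact h2.const_smul (n : ℝ)⁻¹
  · rcases Nat.eq_zero_or_pos n with rfl | hn
    · exact ⟨0, by simpa [Z] using tendsto_const_nhds⟩
    · obtain ⟨l, hl⟩ := (M.cadlag ω).2 (g t)
      have h2 : Tendsto g (𝓝[<] t) (𝓝[<] (g t)) := by
        refine tendsto_nhdsWithin_of_tendsto_nhds_of_eventually_within _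
          (hg.continuousAt.tendsto.mono_left nhdsWithin_le_nhds) ?_
        filter_upwards [self_mem_nhdsWithin] with s hs
        have h3 : (s : ℝ) < t := hs
        have h4 : (0 : ℝ) < t := lt_of_le_of_lt s.2.1 h3
        have h5 : (0 : ℝ≥0) < n := by exact_mod_cast hn
        exact mul_lt_mul_of_pos_left ((Real.toNNReal_lt_toNNReal_iff h4).2 h3) h5
      exact ⟨_, (hl.comp h2).const_smul ((n : ℝ)⁻¹)⟩

/-- The path `(Z_n(t), t ∈ [0,T])` as an element of `D([0,T], ℝ_+^N)`. -/
noncomputable def scaledPath (M : MarkovProcess S Ω) (n : ℕ) (T : ℝ) (ω : Ω) : PathSpace T N where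
  toFun t := M.Z n (Real.toNNReal t) ω
  mem_orthant t i := mul_nonneg (by positivity) (M.subset_orthant (M.X _ ω).2 i)
  cadlag := M.isCadlag_Z n T ω

/-- `τ_{Λ,n}`, the hitting time of `⋃_{i ∈ Λ} {x : x_i = 0}` by `Z_n` (`∞` if it is never hit). -/
noncomputable def hittingTime (M : MarkovProcess S Ω) (Λ : Finset (Fin N)) (n : ℕ) (ω : Ω) : ℝ≥0∞ :=
  ⨅ (t : ℝ≥0) (_ : ∃ i ∈ Λ, M.Z n t ω i = 0), (t : ℝ≥0∞)

/-- `liminf_n inf_{z ∈ 𝓔_n, |z - x| < ε} (1/n) log P_z(A_n)`. -/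
noncomputable def lowerRate (M : MarkovProcess S Ω) (x : RN N) (ε : ℝ) (A : ℕ → Set Ω) : EReal :=
  liminf (fun n : ℕ => ⨅ (z : scaledStates S n) (_ : ‖(z : RN N) - x‖ < ε),
    (((n : ℝ)⁻¹ : ℝ) : EReal) * ENNReal.log (M.scaledLaw n z (A n))) atTop

/-- `limsup_n sup_{z ∈ 𝓔_n, |z - x| < ε} (1/n) log P_z(A_n)`. -/
noncomputable def upperRate (M : MarkovProcess S Ω) (x : RN N) (ε : ℝ) (A : ℕ → Set Ω) : EReal :=
  limsup (fun n : ℕ => ⨆ (z : scaledStates S n) (_ : ‖(z : RN N) - x‖ < ε),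
    (((n : ℝ)⁻¹ : ℝ) : EReal) * ENNReal.log (M.scaledLaw n z (A n))) atTop

/-- Lower large deviation bound. Here and below, limits as `ε → 0` or `δ → 0` are limits of monotone
functions, so that `liminf` and `limsup` along `𝓝[>] 0` both are the limit. -/
def LowerLDBound (M : MarkovProcess S Ω) (T : ℝ) (I : PathSpace T N → ℝ≥0∞) : Prop :=
  ∀ x ∈ orthant N, ∀ O : Set (PathSpace T N), IsOpen O →
    -((⨅ (φ : PathSpace T N) (_ : φ ∈ O) (_ : φ.ext 0 = x), I φ : ℝ≥0∞) : EReal) ≤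
      liminf (fun ε : ℝ => M.lowerRate x ε fun n => {ω | M.scaledPath n T ω ∈ O}) (𝓝[>] 0)

/-- Upper large deviation bound. -/
def UpperLDBound (M : MarkovProcess S Ω) (T : ℝ) (I : PathSpace T N → ℝ≥0∞) : Prop :=
  ∀ x ∈ orthant N, ∀ F : Set (PathSpace T N), IsClosed F →
    limsup (fun ε : ℝ => M.upperRate x ε fun n => {ω | M.scaledPath n T ω ∈ F}) (𝓝[>] 0) ≤
      -((⨅ (φ : PathSpace T N) (_ : φ ∈ F) (_ : φ.ext 0 = x), I φ : ℝ≥0∞) : EReal)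

/-- The sample path large deviation principle with rate function `I`. -/
structure SamplePathLDP (M : MarkovProcess S Ω) (T : ℝ) (I : PathSpace T N → ℝ≥0∞) : Prop where
  lowerSemicontinuous : LowerSemicontinuous I
  lower : M.LowerLDBound T I
  upper : M.UpperLDBound T I

/-- The event `sup_{t ∈ [0,T]} |φ(t) - Z_n(t)| < δ`. -/
def tubeEvent (M : MarkovProcess S Ω) (T : ℝ) (φ : ℝ → RN N) (δ : ℝ) (n : ℕ) : Set Ω :=
  {ω | ⨆ t : Set.Icc (0 : ℝ) T, edist (φ t) (M.Z n (Real.toNNReal t) ω) < ENNReal.ofReal δ}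

/-- Assumption (A₁): the local lower bound for paths `φ(t) = a + t v` with `φ(t) ∈ B_Λ` for
`0 < t < T`. -/
def AssumptionA1 (M : MarkovProcess S Ω) (L : Finset (Fin N) → RN N → ℝ≥0∞) : Prop :=
  ∀ (Λ : Finset (Fin N)) (T : ℝ), 0 < T → ∀ a v : RN N,
    (∀ t ∈ Set.Icc (0 : ℝ) T, a + t • v ∈ orthant N) →
    (∀ t ∈ Set.Ioo (0 : ℝ) T, a + t • v ∈ face Λ) →
    -((ENNReal.ofReal T * L Λ v : ℝ≥0∞) : EReal) ≤
      liminf (fun δ : ℝ => liminf (fun ε : ℝ =>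
        M.lowerRate a ε (M.tubeEvent T (fun t => a + t • v) δ)) (𝓝[>] 0)) (𝓝[>] 0)

/-- Assumption (A₃): the local upper bound for two points of `B_Λ`. -/
def AssumptionA3 (M : MarkovProcess S Ω) (L : Finset (Fin N) → RN N → ℝ≥0∞) : Prop :=
  ∀ (Λ : Finset (Fin N)) (T : ℝ), 0 < T → ∀ x ∈ face Λ, ∀ y ∈ face Λ,
    limsup (fun δ : ℝ => M.upperRate x δ fun n =>
        {ω | ‖M.Z n (Real.toNNReal T) ω - y‖ < δ ∧ ENNReal.ofReal T < M.hittingTime Λ n ω})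
      (𝓝[>] 0) ≤ -((ENNReal.ofReal T * L Λ (T⁻¹ • (y - x)) : ℝ≥0∞) : EReal)

end MarkovProcess

/-- Assumption (A₂): `L_{1,…,N}` is finite in a neighbourhood of `0`. -/
def AssumptionA2 {N : ℕ} (L : Finset (Fin N) → RN N → ℝ≥0∞) : Prop :=
  ∀ᶠ v in 𝓝 (0 : RN N), L Finset.univ v < ⊤

/-! Both bounds compare the process with chains of affine segments, each running inside a single
face (`Reach`). Costs of segments add and, by the Markov property, probabilities multiply, so
estimates for single segments pass to chains. Chains have to be patched where they do not fit
together: by convexity and (A2), `L Finset.univ` is bounded by a constant `C` on a ball of radius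
`r`, so nearby points of the orthant are joined through its interior in a short time and at small
cost (`Reach.detour`).

Lower bound (`expLower_of_rateI_lt`). If `I φ < c`, some piecewise linear `ψ` near `φ` has `J ψ <
c`. It need not start at `φ(0)`, so a detour leads from `φ(0)` to `ψ(0)`, and `ψ` is then followed
with a small delay. (A1), applied segment by segment, shows that the process stays near this chain
with probability at least `e^{-cn}`.

Upper bound. Let `φ` be absolutely continuous, and let `K` be the set of times at which every
coordinate is `0` or at least `κ`. For small `κ` the gaps of `K` have small total length, and `φ`
varies little across them. Two sufficiently close times of `K` give points of the same face, and
(A3) applies between them; on the gaps probabilities are bounded by `1`. The resulting decay rate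
`A` of a tube around `φ` is compared with a chain that replaces gaps by detours: its cost is at most
`A + ζ`, and it stays near `φ`, so its cost cannot be much below `I φ` (`exists_reach_tubeUpper`,
`exists_expUpper_eball`). These local bounds become global by compactness of the level sets of `I'`
(`UpperLDBound.of_local`).

Goodness (`IsGoodRateFunction.of_lower`). The lower bound with `I` and the upper bound with `I'`,
compared on small balls, put every level set of `I` into the closure of a slightly higher level set
of `I'`. -/

namespace MarkovProcess

variable {N : ℕ} {S : Set (RN N)} {Ω : Type*} [MeasurableSpace Ω]

/-! ### The Markov property for events of the whole path -/

/-- The natural filtration. -/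
abbrev past (M : MarkovProcess S Ω) (t : ℝ≥0) : MeasurableSpace Ω :=
  ⨆ u : Set.Iic t, MeasurableSpace.comap (M.X u) inferInstance

theorem past_mono (M : MarkovProcess S Ω) {s t : ℝ≥0} (h : s ≤ t) : M.past s ≤ M.past t :=
  iSup_le fun u => le_iSup_of_le (⟨u, u.2.trans h⟩ : Set.Iic t) le_rfl

theorem past_le (M : MarkovProcess S Ω) (t : ℝ≥0) : M.past t ≤ ‹MeasurableSpace Ω› :=
  iSup_le fun u => (M.measurable_X u).comap_le

theorem measurableSet_past_preimage (M : MarkovProcess S Ω) {s t : ℝ≥0} (h : s ≤ t) {B : Set S}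
    (hB : MeasurableSet B) : MeasurableSet[M.past t] (M.X s ⁻¹' B) :=
  le_iSup (fun u : Set.Iic t => MeasurableSpace.comap (M.X u) inferInstance) ⟨s, h⟩ _ ⟨B, hB, rfl⟩

/-- The Markov property for functions of the state at one later time. -/
theorem setLIntegral_shift (M : MarkovProcess S Ω) (x : S) (s t : ℝ≥0) {A : Set Ω}
    (hA : MeasurableSet[M.past t] A) {h : S → ℝ≥0∞} (hh : Measurable h) :
    ∫⁻ ω in A, h (M.X (t + s) ω) ∂(M.P x) =
      ∫⁻ ω in A, ∫⁻ y, h y ∂(M.kernel s (M.X t ω)) ∂(M.P x) := by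
  have e : ((M.P x).restrict A).map (M.X (t + s)) =
      (((M.P x).restrict A).map (M.X t)).bind (M.kernel s) := by
    ext B hB
    rw [Measure.bind_apply hB (M.kernel s).measurable.aemeasurable,
      lintegral_map ((M.kernel s).measurable_coe hB) (M.measurable_X t),
      Measure.map_apply (M.measurable_X _) hB,
      Measure.restrict_apply (M.measurable_X _ hB), Set.inter_comm]
    exact M.markov x s t A B hA hB
  rw [← lintegral_map hh (M.measurable_X _), e,
    Measure.lintegral_bind (M.kernel s).measurable.aemeasurable hh.aemeasurable,
    lintegral_map hh.lintegral_kernel (M.measurable_X t)]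

/-- The later times are integrated out first: the constraints after the earliest time `b` reduce to
a function of the state at `b`, and one application of the kernel carries it back to time `a`. The
bound `a` is arbitrary so that the induction hypothesis can be used at `b`. -/
theorem exists_measurable_cylinder (M : MarkovProcess S Ω) (B : ℝ≥0 → Set S)
    (hB : ∀ i, MeasurableSet (B i)) (I : Finset ℝ≥0) :
    ∀ a : ℝ≥0, (∀ i ∈ I, a ≤ i) → ∃ g : S → ℝ≥0∞, Measurable g ∧
      ∀ (x : S) (t : ℝ≥0) (A : Set Ω), MeasurableSet[M.past (t + a)] A →
        M.P x (A ∩ {ω | ∀ i ∈ I, M.X (t + i) ω ∈ B i}) = ∫⁻ ω in A, g (M.X (t + a) ω) ∂(M.P x) := by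
  induction I using Finset.induction_on_min with
  | empty => exact fun a _ => ⟨1, measurable_const, fun x t A _ => by simp⟩
  | insert b I hb ih =>
    intro a ha
    obtain ⟨g, hg, hgP⟩ := ih b fun i hi => (hb i hi).le
    have hab : a ≤ b := ha b (Finset.mem_insert_self _ _)
    have hm : Measurable ((B b).indicator g) := hg.indicator (hB b)
    refine ⟨fun y => ∫⁻ y', (B b).indicator g y' ∂(M.kernel (b - a) y), hm.lintegral_kernel,
      fun x t A hA => ?_⟩
    have e1 : A ∩ {ω | ∀ i ∈ insert b I, M.X (t + i) ω ∈ B i} =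
        (A ∩ M.X (t + b) ⁻¹' B b) ∩ {ω | ∀ i ∈ I, M.X (t + i) ω ∈ B i} := by
      ext ω; simp [and_assoc]
    have hA' : MeasurableSet[M.past (t + b)] A := M.past_mono (by gcongr) _ hA
    have e2 : t + b = t + a + (b - a) := by rw [add_assoc, add_tsub_cancel_of_le hab]
    rw [e1, hgP x t _ (hA'.inter (M.measurableSet_past_preimage le_rfl (hB b))),
      ← M.setLIntegral_shift x (b - a) (t + a) hA hm, ← e2, Set.inter_comm,
      ← Measure.restrict_restrict (M.measurable_X _ (hB b)),
      ← lintegral_indicator (M.measurable_X _ (hB b))]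
    rfl

/-- The Markov property for events of the path `ℝ≥0 → S`. -/
theorem markov_path (M : MarkovProcess S Ω) {C : Set (ℝ≥0 → S)} (hC : MeasurableSet C) :
    (Measurable fun y => M.P y {ω | (fun u => M.X u ω) ∈ C}) ∧
      ∀ (x : S) (t : ℝ≥0) (A : Set Ω), MeasurableSet[M.past t] A →
        M.P x (A ∩ {ω | (fun u => M.X (t + u) ω) ∈ C}) =
          ∫⁻ ω in A, M.P (M.X t ω) {ω' | (fun u => M.X u ω') ∈ C} ∂(M.P x) := by
  have hP := M.isProbabilityMeasure
  have hX : ∀ t, Measurable fun ω u => M.X (t + u) ω := fun t =>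
    measurable_pi_lambda _ fun u => M.measurable_X _
  have hX0 : Measurable fun ω u => M.X u ω := measurable_pi_lambda _ fun u => M.measurable_X _
  -- Measurability of `y ↦ P_y(C)` is carried along because complements and countable unions
  -- integrate this function.
  induction C, hC using MeasurableSpace.induction_on_inter
    (s := squareCylinders fun _ : ℝ≥0 => {B : Set S | MeasurableSet B})
    (generateFrom_squareCylinders).symm
    (isPiSystem_squareCylinders (fun _ => MeasurableSpace.isPiSystem_measurableSet)
      fun _ => MeasurableSet.univ (α := S)) with
  | empty => simp
  | basic C hC =>
    obtain ⟨I, B, hB, rfl⟩ := hC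
    obtain ⟨g, hg, hgP⟩ := M.exists_measurable_cylinder B (fun i => hB i trivial) I 0 (by simp)
    -- At time `0` the process sits at `y` almost surely, which identifies the function built from
    -- the kernels with the path law.
    have h0 : ∀ y, M.P y {ω | (fun u => M.X u ω) ∈ (I : Set ℝ≥0).pi B} = g y := by
      intro y
      have := hgP y 0 Set.univ MeasurableSet.univ
      rw [Set.univ_inter, setLIntegral_univ] at this
      have e : ∫⁻ ω, g (M.X (0 + 0) ω) ∂(M.P y) = g y := by
        rw [lintegral_congr_ae (g := fun _ => g y)]
        · simp
        · filter_upwards [M.start y] with ω hω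
          simp [hω]
      rw [← e, ← this]
      simp [Set.mem_pi]
    refine ⟨by simpa only [h0] using hg, fun x t A hA => ?_⟩
    simp only [h0]
    have := hgP x t A (by rwa [add_zero])
    simp only [add_zero] at this
    rw [← this]
    simp [Set.mem_pi]
  | compl C hC ih =>
    have h1 : ∀ y, M.P y {ω | (fun u => M.X u ω) ∈ Cᶜ} =
        1 - M.P y {ω | (fun u => M.X u ω) ∈ C} := by
      intro y
      exact prob_compl_eq_one_sub (hX0 hC)
    refine ⟨by simpa only [h1] using ih.1.const_sub 1, fun x t A hA => ?_⟩
    have h2 : A ∩ {ω | (fun u => M.X (t + u) ω) ∈ Cᶜ} =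
        A \ (A ∩ {ω | (fun u => M.X (t + u) ω) ∈ C}) := by
      ext ω; simp
    have hA' : MeasurableSet A := M.past_le t _ hA
    have h3 : MeasurableSet {ω | (fun u => M.X (t + u) ω) ∈ C} := hX t hC
    rw [h2, measure_sdiff Set.inter_subset_left (hA'.inter h3).nullMeasurableSet
      (measure_ne_top _ _), ih.2 x t A hA]
    simp only [h1]
    have h4 : Measurable fun ω => M.P (M.X t ω) {ω' | (fun u => M.X u ω') ∈ C} :=
      ih.1.comp (M.measurable_X t)
    rw [lintegral_sub h4, setLIntegral_one]
    · exact ((setLIntegral_mono measurable_const fun ω _ => prob_le_one).trans_lt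
        (by simp)).ne
    · exact Eventually.of_forall fun ω => prob_le_one
  | iUnion f hd hf ih =>
    have h1 : ∀ y, M.P y {ω | (fun u => M.X u ω) ∈ ⋃ i, f i} =
        ∑' i, M.P y {ω | (fun u => M.X u ω) ∈ f i} := by
      intro y
      have h3 : {ω | (fun u => M.X u ω) ∈ ⋃ i, f i} = ⋃ i, {ω | (fun u => M.X u ω) ∈ f i} := by
        ext ω; simp
      rw [h3]
      exact measure_iUnion (fun i j hij => (hd hij).preimage _) fun i => hX0 (hf i)
    refine ⟨by simpa only [h1] using Measurable.tsum fun i => (ih i).1, fun x t A hA => ?_⟩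
    have hA' : MeasurableSet A := M.past_le t _ hA
    have h2 : A ∩ {ω | (fun u => M.X (t + u) ω) ∈ ⋃ i, f i} =
        ⋃ i, A ∩ {ω | (fun u => M.X (t + u) ω) ∈ f i} := by
      ext ω; simp
    rw [h2, measure_iUnion]
    · simp only [h1, fun i => (ih i).2 x t A hA]
      exact (lintegral_tsum fun i => ((ih i).1.comp (M.measurable_X t)).aemeasurable).symm
    · intro i j hij
      exact (((hd hij).preimage (fun ω u => M.X (t + u) ω)).inter_left' A).inter_right' A
    · exact fun i => hA'.inter (hX t (hf i))

end MarkovProcess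

/-! ### Tubes as measurable events -/

/-- By right continuity, a violation at `t < l` persists on some interval to the right of `t`, which
contains a rational multiple of `l`. The endpoint `l` cannot be reached in this way and is covered
by `q = 1`. -/
theorem forall_norm_sub_le_of_rat {F : Type*} [NormedAddCommGroup F] {g : ℝ≥0 → F} {f : ℝ → F}
    (hg : ∀ t, ContinuousWithinAt g (Set.Ici t) t) (hf : Continuous f) {l c : ℝ}
    (h : ∀ q : ℚ, 0 ≤ q → q ≤ 1 → ‖g (q * l).toNNReal - f (q * l)‖ ≤ c) :
    ∀ t, 0 ≤ t → t ≤ l → ‖g t.toNNReal - f t‖ ≤ c := by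
  intro t ht htl
  rcases htl.eq_or_lt with rfl | htl
  · simpa using h 1 zero_le_one le_rfl
  by_contra! hc
  have hcont : ContinuousWithinAt (fun s : ℝ => ‖g s.toNNReal - f s‖) (Set.Ici t) t := by
    refine ContinuousWithinAt.norm (ContinuousWithinAt.sub ?_ hf.continuousWithinAt)
    exact (hg t.toNNReal).comp (f := Real.toNNReal) (t := Set.Ici t.toNNReal)
      continuous_real_toNNReal.continuousWithinAt fun s hs => Real.toNNReal_le_toNNReal hs
  have hev := hcont.eventually (lt_mem_nhds hc)
  rw [eventually_nhdsWithin_iff, Metric.eventually_nhds_iff] at hev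
  obtain ⟨ε, hε, hev⟩ := hev
  have hl : 0 < l := ht.trans_lt htl
  have hlt : t / l < min (t + ε) l / l := by
    gcongr
    exact lt_min (by linarith) htl
  obtain ⟨q, hq1, hq2⟩ := exists_rat_btwn hlt
  rw [div_lt_iff₀ hl] at hq1
  rw [lt_div_iff₀ hl] at hq2
  have hq3 : (q : ℝ) * l < l := hq2.trans_le (min_le_right _ _)
  have hq4 : (q : ℝ) * l < t + ε := hq2.trans_le (min_le_left _ _)
  have hq5 : (0 : ℝ) ≤ q := by
    by_contra! hneg
    nlinarith
  have hq6 : (q : ℝ) ≤ 1 := by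
    by_contra! hneg
    nlinarith
  have h1 := hev (y := q * l) (by rw [Real.dist_eq, abs_lt]; constructor <;> linarith) hq1.le
  exact absurd (h q (by exact_mod_cast hq5) (by exact_mod_cast hq6)) (not_le.2 h1)

/-- Trades logarithmic rates in `EReal` for inequalities between probabilities, which the Markov
property can multiply. -/
theorem neg_le_inv_mul_log_iff {n : ℕ} (hn : 1 ≤ n) (p : ℝ≥0∞) (c : ℝ) :
    ((-c : ℝ) : EReal) ≤ (((n : ℝ)⁻¹ : ℝ) : EReal) * ENNReal.log p ↔
      ENNReal.ofReal (Real.exp (-(n * c))) ≤ p := by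
  have hn' : (0 : ℝ) < n := by exact_mod_cast hn
  rw [← ENNReal.log_le_log_iff, ENNReal.log_ofReal_of_pos (Real.exp_pos _), Real.log_exp]
  induction ENNReal.log p with
  | bot =>
    rw [EReal.coe_mul_bot_of_pos (inv_pos.2 hn')]
    exact iff_of_false (not_le.2 (EReal.bot_lt_coe _)) (not_le.2 (EReal.bot_lt_coe _))
  | top => simp [EReal.coe_mul_top_of_pos (inv_pos.2 hn')]
  | coe r =>
    rw [← EReal.coe_mul, EReal.coe_le_coe_iff, EReal.coe_le_coe_iff, inv_mul_eq_div,
      le_div_iff₀ hn']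
    constructor <;> intro h <;> linarith

theorem inv_mul_log_le_neg_iff {n : ℕ} (hn : 1 ≤ n) (p : ℝ≥0∞) (c : ℝ) :
    (((n : ℝ)⁻¹ : ℝ) : EReal) * ENNReal.log p ≤ ((-c : ℝ) : EReal) ↔
      p ≤ ENNReal.ofReal (Real.exp (-(n * c))) := by
  have hn' : (0 : ℝ) < n := by exact_mod_cast hn
  rw [← ENNReal.log_le_log_iff, ENNReal.log_ofReal_of_pos (Real.exp_pos _), Real.log_exp]
  induction ENNReal.log p with
  | bot => simp [EReal.coe_mul_bot_of_pos (inv_pos.2 hn')]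
  | top =>
    rw [EReal.coe_mul_top_of_pos (inv_pos.2 hn')]
    exact iff_of_false (not_le.2 (EReal.coe_lt_top _)) (not_le.2 (EReal.coe_lt_top _))
  | coe r =>
    rw [← EReal.coe_mul, EReal.coe_le_coe_iff, EReal.coe_le_coe_iff, inv_mul_eq_div,
      div_le_iff₀ hn']
    constructor <;> intro h <;> linarith

namespace MarkovProcess

variable {N : ℕ} {S : Set (RN N)} {Ω : Type*} [MeasurableSpace Ω]

theorem continuousWithinAt_Z (M : MarkovProcess S Ω) (n : ℕ) (ω : Ω) (t : ℝ≥0) :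
    ContinuousWithinAt (fun t => M.Z n t ω) (Set.Ici t) t := by
  have h1 : ContinuousWithinAt ((fun s => (M.X s ω : RN N)) ∘ fun s : ℝ≥0 => n * s) (Set.Ici t) t :=
    ((M.cadlag ω).1 (n * t)).comp (t := Set.Ici (n * t)) (by fun_prop)
      fun s hs => by exact mul_le_mul_right (α := ℝ≥0) hs n
  exact h1.const_smul (n : ℝ)⁻¹

/-- The event that `Z_n(a + t)` stays within distance `c` of `f(t)` for `0 ≤ t ≤ l`. -/
def closedTube (M : MarkovProcess S Ω) (n : ℕ) (f : ℝ → RN N) (a : ℝ≥0) (l c : ℝ) : Set Ω :=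
  {ω | ∀ t, 0 ≤ t → t ≤ l → ‖M.Z n (a + t.toNNReal) ω - f t‖ ≤ c}

/-- A measurable set of paths that describes `closedTube`. -/
def ratTube {S : Set (RN N)} (n : ℕ) (f : ℝ → RN N) (l c : ℝ) : Set (ℝ≥0 → S) :=
  ⋂ (q : ℚ) (_ : 0 ≤ q) (_ : q ≤ 1),
    {w | ‖(n : ℝ)⁻¹ • (w (n * (q * l).toNNReal) : RN N) - f (q * l)‖ ≤ c}

theorem measurableSet_ratTube (n : ℕ) (f : ℝ → RN N) (l c : ℝ) :
    MeasurableSet (ratTube (S := S) n f l c) := by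
  refine MeasurableSet.iInter fun q => .iInter fun _ => .iInter fun _ => ?_
  refine measurableSet_le (Measurable.norm (Measurable.sub_const ?_ _)) measurable_const
  exact ((measurable_subtype_coe.comp (measurable_pi_apply _)).const_smul ((n : ℝ)⁻¹))

/-- The same measurable set of paths describes the tube after every shift, which is the form that
`markov_path` needs. -/
theorem setOf_mem_ratTube (M : MarkovProcess S Ω) (n : ℕ) {f : ℝ → RN N} (hf : Continuous f)
    (a : ℝ≥0) {l : ℝ} (hl : 0 ≤ l) (c : ℝ) :
    {ω | (fun u => M.X (n * a + u) ω) ∈ ratTube n f l c} = M.closedTube n f a l c := by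
  ext ω
  have e : ∀ u, (n : ℝ)⁻¹ • (M.X (n * a + n * u) ω : RN N) = M.Z n (a + u) ω := by
    intro u; rw [Z, mul_add]
  simp only [ratTube, Set.mem_ofPred_eq, Set.mem_iInter, e, closedTube]
  constructor
  · refine forall_norm_sub_le_of_rat (g := fun u => M.Z n (a + u) ω) (fun t => ?_) hf
    exact (M.continuousWithinAt_Z n ω (a + t)).comp (f := fun u => a + u) (t := Set.Ici (a + t))
      (by fun_prop) fun s hs => by exact add_le_add_right (α := ℝ≥0) hs a
  · intro h q hq0 hq1
    have h0 : (0 : ℝ) ≤ q := by exact_mod_cast hq0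
    have h1 : (q : ℝ) ≤ 1 := by exact_mod_cast hq1
    exact h _ (by positivity) (by nlinarith)

theorem measurableSet_closedTube (M : MarkovProcess S Ω) (n : ℕ) {f : ℝ → RN N} (hf : Continuous f)
    {l : ℝ} (hl : 0 ≤ l) (c : ℝ) :
    MeasurableSet[M.past (n * l.toNNReal)] (M.closedTube n f 0 l c) := by
  rw [← M.setOf_mem_ratTube n hf 0 hl c]
  have : {ω | (fun u => M.X (n * 0 + u) ω) ∈ ratTube n f l c} =
      ⋂ (q : ℚ) (_ : 0 ≤ q) (_ : q ≤ 1), M.X (n * (q * l).toNNReal) ⁻¹'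
        {y | ‖(n : ℝ)⁻¹ • (y : RN N) - f (q * l)‖ ≤ c} := by
    ext ω; simp [ratTube]
  rw [this]
  refine MeasurableSet.iInter fun q => .iInter fun _ => .iInter fun hq => ?_
  refine M.measurableSet_past_preimage ?_ ?_
  · have h1 : (q : ℝ) ≤ 1 := by exact_mod_cast hq
    gcongr
    nlinarith
  · exact measurableSet_le (Measurable.norm (Measurable.sub_const
      (measurable_subtype_coe.const_smul ((n : ℝ)⁻¹)) _)) measurable_const

theorem measurableSet_past_Z (M : MarkovProcess S Ω) (n : ℕ) (p : RN N) (a : ℝ≥0) (c : ℝ) :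
    MeasurableSet[M.past (n * a)] {ω | ‖M.Z n a ω - p‖ ≤ c} :=
  M.measurableSet_past_preimage (B := {y | ‖(n : ℝ)⁻¹ • (y : RN N) - p‖ ≤ c}) le_rfl
    (measurableSet_le (Measurable.norm (Measurable.sub_const
      (measurable_subtype_coe.const_smul ((n : ℝ)⁻¹)) _)) measurable_const)

theorem isProbabilityMeasure_scaledLaw (M : MarkovProcess S Ω) (n : ℕ) (z : scaledStates S n) :
    IsProbabilityMeasure (M.scaledLaw n z) := M.isProbabilityMeasure _

/-- The Markov property of `Z_n` for tubes. -/
theorem scaledLaw_inter_closedTube (M : MarkovProcess S Ω) (n : ℕ) (z : scaledStates S n)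
    {f : ℝ → RN N} (hf : Continuous f) (a : ℝ≥0) {l : ℝ} (hl : 0 ≤ l) (c : ℝ) {A : Set Ω}
    (hA : MeasurableSet[M.past (n * a)] A) :
    M.scaledLaw n z (A ∩ M.closedTube n f a l c) =
      ∫⁻ ω in A, M.P (M.X (n * a) ω) (M.closedTube n f 0 l c) ∂(M.scaledLaw n z) := by
  have h := (M.markov_path (measurableSet_ratTube (S := S) n f l c)).2
    ⟨(n : ℝ) • (z : RN N), z.2⟩ (n * a) A hA
  have e : {ω | (fun u => M.X u ω) ∈ ratTube n f l c} = M.closedTube n f 0 l c := by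
    simpa using M.setOf_mem_ratTube n hf 0 hl c
  rw [M.setOf_mem_ratTube n hf a hl c, e] at h
  exact h

theorem exists_scaledLaw_eq (M : MarkovProcess S Ω) {n : ℕ} (hn : 1 ≤ n) (a : ℝ≥0) (ω : Ω) :
    ∃ z : scaledStates S n, (z : RN N) = M.Z n a ω ∧ M.P (M.X (n * a) ω) = M.scaledLaw n z := by
  have hn' : (n : ℝ) ≠ 0 := by positivity
  have e : (n : ℝ) • M.Z n a ω = (M.X (n * a) ω : RN N) := by
    rw [Z, smul_inv_smul₀ hn']
  refine ⟨⟨M.Z n a ω, by simp [scaledStates, e]⟩, rfl, ?_⟩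
  simp [scaledLaw, e]

/-- Given the past, the tube has the probability that it has for the process restarted at `Z_n(a)`,
and on `A` this point is `ε`-close to `p`. All later uses of the Markov property go through this
estimate and its counterpart `scaledLaw_inter_le_mul`. -/
theorem mul_le_scaledLaw_inter (M : MarkovProcess S Ω) {n : ℕ} (hn : 1 ≤ n) (z : scaledStates S n)
    {f : ℝ → RN N} (hf : Continuous f) (a : ℝ≥0) {l : ℝ} (hl : 0 ≤ l) (c : ℝ) {A : Set Ω}
    (hA : MeasurableSet[M.past (n * a)] A) {p : RN N} {ε : ℝ} {κ : ℝ≥0∞}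
    (hAp : ∀ ω ∈ A, ‖M.Z n a ω - p‖ < ε)
    (hκ : ∀ z' : scaledStates S n, ‖(z' : RN N) - p‖ < ε →
      κ ≤ M.scaledLaw n z' (M.closedTube n f 0 l c)) :
    κ * M.scaledLaw n z A ≤ M.scaledLaw n z (A ∩ M.closedTube n f a l c) := by
  rw [M.scaledLaw_inter_closedTube n z hf a hl c hA, ← setLIntegral_const]
  refine setLIntegral_mono' (M.past_le _ _ hA) fun ω hω => ?_
  obtain ⟨z', hz', e⟩ := M.exists_scaledLaw_eq hn a ω
  rw [e]
  exact hκ z' (hz' ▸ hAp ω hω)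

theorem scaledLaw_inter_le_mul (M : MarkovProcess S Ω) {n : ℕ} (hn : 1 ≤ n) (z : scaledStates S n)
    {f : ℝ → RN N} (hf : Continuous f) (a : ℝ≥0) {l : ℝ} (hl : 0 ≤ l) (c : ℝ) {A : Set Ω}
    (hA : MeasurableSet[M.past (n * a)] A) {p : RN N} {ε : ℝ} {κ : ℝ≥0∞}
    (hAp : ∀ ω ∈ A, ‖M.Z n a ω - p‖ < ε)
    (hκ : ∀ z' : scaledStates S n, ‖(z' : RN N) - p‖ < ε →
      M.scaledLaw n z' (M.closedTube n f 0 l c) ≤ κ) :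
    M.scaledLaw n z (A ∩ M.closedTube n f a l c) ≤ κ * M.scaledLaw n z A := by
  rw [M.scaledLaw_inter_closedTube n z hf a hl c hA, ← setLIntegral_const]
  refine setLIntegral_mono' (M.past_le _ _ hA) fun ω hω => ?_
  obtain ⟨z', hz', e⟩ := M.exists_scaledLaw_eq hn a ω
  rw [e]
  exact hκ z' (hz' ▸ hAp ω hω)

/-! ### Exponential bounds for probabilities -/

/-- `P_z(A_n) ≥ e^{-cn}` for large `n` and all `z` near `x`. -/
def ExpLower (M : MarkovProcess S Ω) (x : RN N) (A : ℕ → Set Ω) (c : ℝ) : Prop :=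
  ∃ ε > 0, ∀ᶠ n : ℕ in atTop, ∀ z : scaledStates S n, ‖(z : RN N) - x‖ < ε →
    ENNReal.ofReal (Real.exp (-(n * c))) ≤ M.scaledLaw n z (A n)

/-- `P_z(A_n) ≤ e^{-cn}` for large `n` and all `z` near `x`. -/
def ExpUpper (M : MarkovProcess S Ω) (x : RN N) (A : ℕ → Set Ω) (c : ℝ) : Prop :=
  ∃ ε > 0, ∀ᶠ n : ℕ in atTop, ∀ z : scaledStates S n, ‖(z : RN N) - x‖ < ε →
    M.scaledLaw n z (A n) ≤ ENNReal.ofReal (Real.exp (-(n * c)))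

theorem eventually_le_of_lt_lowerRate (M : MarkovProcess S Ω) {x : RN N} {ε : ℝ} {A : ℕ → Set Ω}
    {c : ℝ} (h : ((-c : ℝ) : EReal) < M.lowerRate x ε A) :
    ∀ᶠ n : ℕ in atTop, ∀ z : scaledStates S n, ‖(z : RN N) - x‖ < ε →
      ENNReal.ofReal (Real.exp (-(n * c))) ≤ M.scaledLaw n z (A n) := by
  filter_upwards [eventually_lt_of_lt_liminf h, eventually_ge_atTop 1] with n hn h1 z hz
  exact (neg_le_inv_mul_log_iff h1 _ _).1 (hn.le.trans (iInf₂_le z hz))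

theorem eventually_le_of_upperRate_lt (M : MarkovProcess S Ω) {x : RN N} {ε : ℝ} {A : ℕ → Set Ω}
    {c : ℝ} (h : M.upperRate x ε A < ((-c : ℝ) : EReal)) :
    ∀ᶠ n : ℕ in atTop, ∀ z : scaledStates S n, ‖(z : RN N) - x‖ < ε →
      M.scaledLaw n z (A n) ≤ ENNReal.ofReal (Real.exp (-(n * c))) := by
  filter_upwards [eventually_lt_of_limsup_lt h, eventually_ge_atTop 1] with n hn h1 z hz
  exact (inv_mul_log_le_neg_iff h1 _ _).1 ((le_iSup₂ (f := fun (z : scaledStates S n)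
    (_ : ‖(z : RN N) - x‖ < ε) => (((n : ℝ)⁻¹ : ℝ) : EReal) * ENNReal.log (M.scaledLaw n z (A n)))
    z hz).trans hn.le)

theorem ExpLower.le_liminf {M : MarkovProcess S Ω} {x : RN N} {A : ℕ → Set Ω} {c : ℝ}
    (h : M.ExpLower x A c) :
    ((-c : ℝ) : EReal) ≤ liminf (fun ε : ℝ => M.lowerRate x ε A) (𝓝[>] 0) := by
  obtain ⟨ε, hε, h⟩ := h
  refine le_liminf_of_le (by isBoundedDefault) ?_
  filter_upwards [Ioo_mem_nhdsGT hε] with ε' hε'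
  refine le_liminf_of_le (by isBoundedDefault) ?_
  filter_upwards [h, eventually_ge_atTop 1] with n hn h1
  exact le_iInf₂ fun z hz => (neg_le_inv_mul_log_iff h1 _ _).2 (hn z (hz.trans hε'.2))

theorem ExpUpper.limsup_le {M : MarkovProcess S Ω} {x : RN N} {A : ℕ → Set Ω} {c : ℝ}
    (h : M.ExpUpper x A c) :
    limsup (fun ε : ℝ => M.upperRate x ε A) (𝓝[>] 0) ≤ ((-c : ℝ) : EReal) := by
  obtain ⟨ε, hε, h⟩ := h
  refine limsup_le_of_le (by isBoundedDefault) ?_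
  filter_upwards [Ioo_mem_nhdsGT hε] with ε' hε'
  refine limsup_le_of_le (by isBoundedDefault) ?_
  filter_upwards [h, eventually_ge_atTop 1] with n hn h1
  exact iSup₂_le fun z hz => (inv_mul_log_le_neg_iff h1 _ _).2 (hn z (hz.trans hε'.2))

theorem expLower_of_lt_liminf {M : MarkovProcess S Ω} {x : RN N} {A : ℕ → Set Ω} {c : ℝ}
    (h : ((-c : ℝ) : EReal) < liminf (fun ε : ℝ => M.lowerRate x ε A) (𝓝[>] 0)) :
    M.ExpLower x A c := by
  obtain ⟨ε, hε, hε0⟩ := ((eventually_lt_of_lt_liminf h).and self_mem_nhdsWithin).exists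
  exact ⟨ε, hε0, M.eventually_le_of_lt_lowerRate hε⟩

theorem expUpper_of_limsup_lt {M : MarkovProcess S Ω} {x : RN N} {A : ℕ → Set Ω} {c : ℝ}
    (h : limsup (fun ε : ℝ => M.upperRate x ε A) (𝓝[>] 0) < ((-c : ℝ) : EReal)) :
    M.ExpUpper x A c := by
  obtain ⟨ε, hε, hε0⟩ := ((eventually_lt_of_limsup_lt h).and self_mem_nhdsWithin).exists
  exact ⟨ε, hε0, M.eventually_le_of_upperRate_lt hε⟩

theorem ExpLower.mono {M : MarkovProcess S Ω} {x : RN N} {A B : ℕ → Set Ω} {c d : ℝ}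
    (h : M.ExpLower x A c) (hAB : ∀ n, A n ⊆ B n) (hcd : c ≤ d) : M.ExpLower x B d := by
  obtain ⟨ε, hε, h⟩ := h
  refine ⟨ε, hε, h.mono fun n hn z hz => le_trans ?_ ((hn z hz).trans (measure_mono (hAB n)))⟩
  gcongr

theorem ExpUpper.mono {M : MarkovProcess S Ω} {x : RN N} {A B : ℕ → Set Ω} {c d : ℝ}
    (h : M.ExpUpper x B d) (hAB : ∀ n, A n ⊆ B n) (hcd : c ≤ d) : M.ExpUpper x A c := by
  obtain ⟨ε, hε, h⟩ := h
  refine ⟨ε, hε, h.mono fun n hn z hz => ((measure_mono (hAB n)).trans (hn z hz)).trans ?_⟩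
  gcongr

/-- Exponential decay of a finite union, at any smaller rate. -/
theorem expUpper_biUnion {M : MarkovProcess S Ω} {x : RN N} {ι : Type*} (I : Finset ι)
    {A : ι → ℕ → Set Ω} {c d : ℝ} (hcd : c < d) (h : ∀ i ∈ I, M.ExpUpper x (A i) d) :
    M.ExpUpper x (fun n => ⋃ i ∈ I, A i n) c := by
  classical
  suffices H : ∃ ε > 0, ∀ᶠ n : ℕ in atTop, ∀ z : scaledStates S n, ‖(z : RN N) - x‖ < ε →
      M.scaledLaw n z (⋃ i ∈ I, A i n) ≤ I.card * ENNReal.ofReal (Real.exp (-(n * d))) by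
    obtain ⟨ε, hε, H⟩ := H
    refine ⟨ε, hε, ?_⟩
    -- The gap `d - c` absorbs the number of events.
    have ht : Tendsto (fun n : ℕ => Real.exp (n * (d - c))) atTop atTop :=
      Real.tendsto_exp_atTop.comp
        (tendsto_natCast_atTop_atTop.atTop_mul_const (sub_pos.2 hcd))
    filter_upwards [H, ht.eventually_ge_atTop (I.card : ℝ)] with n hn hn' z hz
    refine (hn z hz).trans ?_
    rw [← ENNReal.ofReal_natCast, ← ENNReal.ofReal_mul (by positivity)]
    refine ENNReal.ofReal_le_ofReal ?_
    calc (I.card : ℝ) * Real.exp (-(n * d)) ≤ Real.exp (n * (d - c)) * Real.exp (-(n * d)) := by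
          gcongr
      _ = Real.exp (-(n * c)) := by rw [← Real.exp_add]; congr 1; ring
  induction I using Finset.induction_on with
  | empty => exact ⟨1, one_pos, by simp⟩
  | insert i I hi ih =>
    obtain ⟨ε, hε, h1⟩ := ih fun j hj => h j (Finset.mem_insert_of_mem hj)
    obtain ⟨ε', hε', h2⟩ := h i (Finset.mem_insert_self _ _)
    refine ⟨min ε ε', lt_min hε hε', ?_⟩
    filter_upwards [h1, h2] with n h1 h2 z hz
    rw [Finset.set_biUnion_insert, Finset.card_insert_of_notMem hi, Nat.cast_add, Nat.cast_one,
      add_mul, one_mul, add_comm]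
    exact (measure_union_le _ _).trans (add_le_add (h2 z (hz.trans_le (min_le_right _ _)))
      (h1 z (hz.trans_le (min_le_left _ _))))

end MarkovProcess

/-! ### The Skorohod topology near continuous paths -/

namespace PathSpace

variable {T : ℝ} {N : ℕ}

theorem ext_apply (φ : PathSpace T N) (t : Set.Icc (0 : ℝ) T) : φ.ext t = φ.toFun t := by
  rw [ext, dif_pos t.2]

theorem edist_le_of_forall {φ ψ : PathSpace T N} {r : ℝ≥0∞}
    (h : ∀ t, edist (φ.toFun t) (ψ.toFun t) ≤ r) : edist φ ψ ≤ r := by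
  refine (iInf_le _ (OrderIso.refl _)).trans (max_le (iSup_le fun t => ?_) (iSup_le h))
  simp

theorem exists_orderIso_of_edist_lt {φ ψ : PathSpace T N} {r : ℝ≥0∞} (h : edist φ ψ < r) :
    ∃ θ : Set.Icc (0 : ℝ) T ≃o Set.Icc (0 : ℝ) T, ∀ t, edist (θ t) t < r ∧
      edist (φ.toFun t) (ψ.toFun (θ t)) < r := by
  obtain ⟨θ, hθ⟩ := iInf_lt_iff.1 h
  exact ⟨θ, fun t => ⟨(le_iSup (fun t => edist (θ t) t) t).trans_lt ((le_max_left _ _).trans_lt hθ),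
    (le_iSup (fun t => edist (φ.toFun t) (ψ.toFun (θ t))) t).trans_lt
      ((le_max_right _ _).trans_lt hθ)⟩⟩

/-- Every increasing bijection of `[0,T]` fixes `0`. -/
theorem edist_ext_zero_le (hT : 0 ≤ T) (φ ψ : PathSpace T N) :
    edist (φ.ext 0) (ψ.ext 0) ≤ edist φ ψ := by
  refine le_of_forall_gt fun r hr => ?_
  obtain ⟨θ, hθ⟩ := exists_orderIso_of_edist_lt hr
  have h0 : (0 : ℝ) ∈ Set.Icc 0 T := ⟨le_rfl, hT⟩
  have e : θ ⟨0, h0⟩ = ⟨0, h0⟩ :=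
    le_antisymm ((θ.le_symm_apply).1 (Subtype.mk_le_mk.2 (θ.symm _).2.1)) (θ ⟨0, h0⟩).2.1
  have := (hθ ⟨0, h0⟩).2
  rw [e] at this
  rwa [← ext_apply, ← ext_apply] at this

theorem continuous_ext_zero (hT : 0 ≤ T) : Continuous fun φ : PathSpace T N => φ.ext 0 :=
  (LipschitzWith.of_edist_le fun φ ψ => edist_ext_zero_le hT φ ψ).continuous

/-- A small time change moves the values of a uniformly continuous path only a little, so Skorohod
balls around a continuous path lie in uniform tubes. -/
theorem exists_forall_norm_sub_le {φ : PathSpace T N} (hφ : Continuous φ.toFun) {δ : ℝ}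
    (hδ : 0 < δ) : ∃ δ' > 0, ∀ χ : PathSpace T N, edist φ χ < ENNReal.ofReal δ' →
      ∀ t, ‖χ.toFun t - φ.toFun t‖ ≤ δ := by
  obtain ⟨η, hη, hu⟩ := Metric.uniformContinuous_iff.1
    (CompactSpace.uniformContinuous_of_continuous hφ) (δ / 2) (half_pos hδ)
  refine ⟨min η (δ / 2), lt_min hη (half_pos hδ), fun χ hχ t => ?_⟩
  obtain ⟨θ, hθ⟩ := exists_orderIso_of_edist_lt hχ
  obtain ⟨h1, h2⟩ := hθ (θ.symm t)
  rw [θ.apply_symm_apply, edist_dist, ENNReal.ofReal_lt_ofReal_iff (lt_min hη (half_pos hδ)),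
    lt_min_iff] at h1 h2
  rw [← dist_eq_norm, dist_comm]
  refine (dist_triangle _ (φ.toFun (θ.symm t)) _).trans ?_
  have := hu h1.1
  linarith [h2.2]

/-- The time-changed paths `ψ ∘ θ` are still continuous and converge to `φ` uniformly. Hence a
finite value of `rateI` forces continuity. -/
theorem continuous_toFun_of_approx {φ : PathSpace T N}
    (h : ∀ r > 0, ∃ ψ : PathSpace T N, Continuous ψ.toFun ∧ edist φ ψ < ENNReal.ofReal r) :
    Continuous φ.toFun := by
  refine continuous_of_uniform_approx_of_continuous fun u hu => ?_
  obtain ⟨r, hr, hru⟩ := Metric.mem_uniformity_dist.1 hu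
  obtain ⟨ψ, hψ, hd⟩ := h r hr
  obtain ⟨θ, hθ⟩ := exists_orderIso_of_edist_lt hd
  refine ⟨ψ.toFun ∘ θ, hψ.comp θ.continuous, fun t => hru ?_⟩
  have := (hθ t).2
  rwa [edist_dist, ENNReal.ofReal_lt_ofReal_iff hr] at this

theorem toFun_eq_of_edist_eq_zero {φ ψ : PathSpace T N} (hφ : Continuous φ.toFun)
    (h : edist φ ψ = 0) : ψ.toFun = φ.toFun := by
  funext t
  rw [← sub_eq_zero, ← norm_le_zero_iff]
  refine le_of_forall_pos_le_add fun δ hδ => ?_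
  obtain ⟨δ', hδ', H⟩ := exists_forall_norm_sub_le hφ hδ
  rw [zero_add]
  exact H ψ (by rw [h]; exact ENNReal.ofReal_pos.2 hδ') t

theorem ext_eq_of_toFun_eq {φ ψ : PathSpace T N} (h : φ.toFun = ψ.toFun) : φ.ext = ψ.ext := by
  funext t; simp [ext, h]

theorem IsPiecewiseLinear.continuousOn_ext {ψ : PathSpace T N} (h : ψ.IsPiecewiseLinear) :
    ContinuousOn ψ.ext (Set.Icc 0 T) := by
  obtain ⟨n, τ, hm, h0, hn, hτ⟩ := h
  have key : ∀ k ≤ n, ContinuousOn ψ.ext (Set.Icc 0 (τ k)) := by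
    intro k
    induction k with
    | zero => simp [h0]
    | succ k ih =>
      intro hk
      have h1 : (0 : ℝ) ≤ τ k := h0 ▸ hm (Nat.zero_le _)
      have h2 : τ (k + 1) ≤ T := hn ▸ hm hk
      rw [← Set.Icc_union_Icc_eq_Icc h1 (hm k.le_succ)]
      refine (ih (by omega)).union_of_isClosed ?_ isClosed_Icc isClosed_Icc
      obtain ⟨a, v, hav⟩ := hτ k (by omega)
      have : ContinuousOn (fun t : ℝ => a + t • v) (Set.Icc (τ k) (τ (k + 1))) := by fun_prop
      refine this.congr fun t ht => ?_
      have ht' : t ∈ Set.Icc 0 T := ⟨h1.trans ht.1, ht.2.trans h2⟩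
      exact (ext_apply ψ ⟨t, ht'⟩).trans (hav ⟨t, ht'⟩ ht.1 ht.2)
  exact hn ▸ key n le_rfl

theorem continuous_toFun_iff {ψ : PathSpace T N} :
    Continuous ψ.toFun ↔ ContinuousOn ψ.ext (Set.Icc 0 T) := by
  rw [continuousOn_iff_continuous_domRestrict]
  have : ψ.toFun = (Set.Icc 0 T).domRestrict ψ.ext := by
    funext t; exact (ext_apply ψ t).symm
  rw [this]

end PathSpace

/-! ### The rate function as a relaxation -/

theorem exists_isPiecewiseLinear_of_rateI_lt {N : ℕ} {L : Finset (Fin N) → RN N → ℝ≥0∞} {T : ℝ}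
    {φ : PathSpace T N} {c : ℝ≥0∞} (h : rateI L T φ < c) {r : ℝ} (hr : 0 < r) :
    ∃ ψ : PathSpace T N, ψ.IsPiecewiseLinear ∧ edist φ ψ < ENNReal.ofReal r ∧ actionJ L ψ < c := by
  obtain ⟨δ, h1, h2⟩ := ((frequently_lt_of_liminf_lt (by isBoundedDefault) h).and_eventually
    (Ioo_mem_nhdsGT hr)).exists
  simp only [iInf_lt_iff] at h1
  obtain ⟨ψ, hψ, hd, hJ⟩ := h1
  exact ⟨ψ, hψ, hd.trans_le (ENNReal.ofReal_le_ofReal h2.2.le), hJ⟩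

theorem exists_forall_lt_actionJ_of_lt_rateI {N : ℕ} {L : Finset (Fin N) → RN N → ℝ≥0∞} {T : ℝ}
    {φ : PathSpace T N} {c : ℝ≥0∞} (h : c < rateI L T φ) :
    ∃ r > 0, ∀ ψ : PathSpace T N, ψ.IsPiecewiseLinear → edist φ ψ < ENNReal.ofReal r →
      c < actionJ L ψ := by
  obtain ⟨δ, h1, h2⟩ := ((eventually_lt_of_lt_liminf h).and self_mem_nhdsWithin).exists
  exact ⟨δ, h2, fun ψ hψ hd => h1.trans_le (iInf₂_le_of_le ψ hψ (iInf_le _ hd))⟩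

/-- A relaxation over shrinking balls is lower semicontinuous: half of a radius that works at `φ`
works at all points of the half ball. -/
theorem lowerSemicontinuous_rateI {N : ℕ} (L : Finset (Fin N) → RN N → ℝ≥0∞) (T : ℝ) :
    LowerSemicontinuous (rateI L T) := by
  intro φ c hc
  obtain ⟨d, hcd, hd⟩ := exists_between hc
  obtain ⟨r, hr, H⟩ := exists_forall_lt_actionJ_of_lt_rateI hd
  filter_upwards [Metric.eball_mem_nhds φ (ENNReal.ofReal_pos.2 (half_pos hr))] with χ hχ
  refine hcd.trans_le (not_lt.1 fun hlt => ?_)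
  obtain ⟨ψ, hψ, hdist, hJ⟩ := exists_isPiecewiseLinear_of_rateI_lt hlt (half_pos hr)
  refine absurd (H ψ hψ ?_) (not_lt.2 hJ.le)
  calc edist φ ψ ≤ edist φ χ + edist χ ψ := edist_triangle _ _ _
    _ < ENNReal.ofReal (r / 2) + ENNReal.ofReal (r / 2) :=
      ENNReal.add_lt_add (by rw [edist_comm]; exact hχ) hdist
    _ = ENNReal.ofReal r := by
      rw [← ENNReal.ofReal_add (half_pos hr).le (half_pos hr).le, add_halves]

/-! ### Affine segments -/

/-- A nonnegative affine function on `[0,w]` that vanishes at an interior point vanishes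
identically, so the set of positive coordinates is constant on the open interval. -/
theorem exists_face_of_segment {N : ℕ} {p v : RN N} {w : ℝ}
    (h : ∀ t ∈ Set.Icc (0 : ℝ) w, p + t • v ∈ orthant N) :
    ∃ Λ, ∀ t ∈ Set.Ioo (0 : ℝ) w, p + t • v ∈ face Λ := by
  refine ⟨posSet (p + (w / 2) • v), fun t ht => ⟨h t ⟨ht.1.le, ht.2.le⟩, ?_⟩⟩
  have key : ∀ s ∈ Set.Ioo (0 : ℝ) w, ∀ t ∈ Set.Ioo (0 : ℝ) w, ∀ i,
      0 < (p + s • v) i → 0 < (p + t • v) i := by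
    intro s hs t ht i hi
    by_contra! hneg
    have h0 := h 0 ⟨le_rfl, (hs.1.trans hs.2).le⟩ i
    have h1 := h w ⟨(hs.1.trans hs.2).le, le_rfl⟩ i
    simp only [PiLp.add_apply, PiLp.smul_apply, smul_eq_mul, zero_mul, add_zero] at *
    rcases le_total 0 (v i) with hv | hv
    · have h2 : p i = 0 := by nlinarith [mul_nonneg ht.1.le hv]
      have h3 : v i ≤ 0 := by
        by_contra! h3
        nlinarith [mul_pos ht.1 h3]
      have h4 : v i = 0 := le_antisymm h3 hv
      simp [h2, h4] at hi
    · have h2 : (t - s) * v i < 0 := by nlinarith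
      have h3 : v i < 0 := by
        rcases hv.lt_or_eq with h | h
        · exact h
        · simp [h] at h2
      nlinarith [mul_pos_of_neg_of_neg (sub_neg.2 ht.2) h3]
  have hw : w / 2 ∈ Set.Ioo (0 : ℝ) w := ⟨by linarith [ht.1, ht.2], by linarith [ht.1, ht.2]⟩
  ext i
  simp only [posSet, Finset.mem_filter, Finset.mem_univ, true_and]
  exact ⟨key t ht _ hw i, key _ hw t ht i⟩

theorem setLIntegral_segment {N : ℕ} (L : Finset (Fin N) → RN N → ℝ≥0∞) {f : ℝ → RN N} {a b : ℝ}
    {p v : RN N} {Λ : Finset (Fin N)} (hf : ∀ t ∈ Set.Ioo a b, f t = p + t • v)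
    (hΛ : ∀ t ∈ Set.Ioo a b, posSet (f t) = Λ) :
    ∫⁻ t in Set.Ioc a b, L (posSet (f t)) (deriv f t) = ENNReal.ofReal (b - a) * L Λ v := by
  rw [setLIntegral_congr Ioo_ae_eq_Ioc.symm, setLIntegral_congr_fun (g := fun _ => L Λ v)
    measurableSet_Ioo, setLIntegral_const, Real.volume_Ioo, mul_comm]
  intro t ht
  have : f =ᶠ[𝓝 t] fun t => p + t • v := by
    filter_upwards [Ioo_mem_nhds ht.1 ht.2] with s hs using hf s hs
  have hd : deriv (fun t : ℝ => p + t • v) t = v := by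
    have := ((hasDerivAt_id t).smul_const v).const_add p
    simpa using this.deriv
  simp only [hΛ t ht, this.deriv_eq, hd]

/-- `Reach L g ρ x τ p c`: a chain of affine segments in the orthant, each of them in a single open
face, leads from `x` at time `0` to `p` at time `τ`, at total cost `c` and within distance `ρ` of
`g`. -/
inductive Reach {N : ℕ} (L : Finset (Fin N) → RN N → ℝ≥0∞) (g : ℝ → RN N) (ρ : ℝ) (x : RN N) :
    ℝ → RN N → ℝ≥0∞ → Prop
  | start (hx : x ∈ orthant N) (hg : ‖x - g 0‖ ≤ ρ) : Reach L g ρ x 0 x 0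
  | step {τ : ℝ} {p : RN N} {c : ℝ≥0∞} (h : Reach L g ρ x τ p c) {w : ℝ} (hw : 0 < w) {v : RN N}
      {Λ : Finset (Fin N)} (ho : ∀ t ∈ Set.Icc (0 : ℝ) w, p + t • v ∈ orthant N)
      (hΛ : ∀ t ∈ Set.Ioo (0 : ℝ) w, p + t • v ∈ face Λ)
      (hg : ∀ t ∈ Set.Icc (0 : ℝ) w, ‖p + t • v - g (τ + t)‖ ≤ ρ) :
      Reach L g ρ x (τ + w) (p + w • v) (c + ENNReal.ofReal w * L Λ v)

namespace Reach

variable {N : ℕ} {L : Finset (Fin N) → RN N → ℝ≥0∞} {g : ℝ → RN N} {ρ : ℝ} {x : RN N} {τ : ℝ}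
  {p : RN N} {c : ℝ≥0∞}

theorem time_nonneg (h : Reach L g ρ x τ p c) : 0 ≤ τ := by
  induction h with
  | start => exact le_rfl
  | step _ hw => linarith

theorem mem_orthant (h : Reach L g ρ x τ p c) : p ∈ orthant N := by
  induction h with
  | start hx => exact hx
  | step _ hw ho => exact ho _ ⟨hw.le, le_rfl⟩

/-- The segments are concatenated. Nodes are a null set, and off the nodes derivatives are local, so
the integral splits into the costs of the segments. -/
theorem exists_function (h : Reach L g ρ x τ p c) :
    ∃ f : ℝ → RN N, Continuous f ∧ f 0 = x ∧ f τ = p ∧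
      (∀ t ∈ Set.Icc 0 τ, f t ∈ orthant N ∧ ‖f t - g t‖ ≤ ρ) ∧
      (∃ (n : ℕ) (σ : ℕ → ℝ), Monotone σ ∧ σ 0 = 0 ∧ σ n = τ ∧ ∀ i < n, ∃ a v : RN N,
        ∀ t, σ i ≤ t → t ≤ σ (i + 1) → f t = a + t • v) ∧
      ∫⁻ t in Set.Ioc 0 τ, L (posSet (f t)) (deriv f t) = c := by
  induction h with
  | start hx hg =>
    refine ⟨fun _ => x, continuous_const, rfl, rfl, fun t ht => ?_,
      ⟨0, fun _ => 0, monotone_const, rfl, rfl, by simp⟩, by simp⟩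
    obtain rfl : t = 0 := le_antisymm ht.2 ht.1
    exact ⟨hx, hg⟩
  | @step τ p c h w hw v Λ ho hΛ hg ih =>
    obtain ⟨f, hf, hf0, hfτ, hft, ⟨n, σ, hm, h0, hn, hσ⟩, hint⟩ := ih
    have hτ := h.time_nonneg
    let f' : ℝ → RN N := fun t => if t ≤ τ then f t else p + (t - τ) • v
    have e1 : ∀ t, t ≤ τ → f' t = f t := fun t ht => if_pos ht
    have e2 : ∀ t, τ ≤ t → f' t = p + (t - τ) • v := by
      intro t ht
      rcases ht.eq_or_lt with rfl | ht
      · simp [e1 _ le_rfl, hfτ]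
      · exact if_neg (not_le.2 ht)
    refine ⟨f', ?_, ?_, ?_, ?_, ⟨n + 1, fun i => if i ≤ n then σ i else τ + w, ?_, ?_, ?_, ?_⟩, ?_⟩
    · refine Continuous.if_le hf (by fun_prop) continuous_id continuous_const ?_
      rintro t rfl
      simp [hfτ]
    · rw [e1 _ hτ, hf0]
    · rw [e2 _ (by linarith)]; simp
    · intro t ht
      rcases le_total t τ with h1 | h1
      · rw [e1 t h1]; exact hft t ⟨ht.1, h1⟩
      · rw [e2 t h1]
        have h2 : t - τ ∈ Set.Icc 0 w := ⟨by linarith, by linarith [ht.2]⟩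
        refine ⟨ho _ h2, ?_⟩
        have := hg _ h2
        rwa [add_sub_cancel] at this
    · refine monotone_nat_of_le_succ fun i => ?_
      split_ifs with h1 h2 h2
      · exact hm i.le_succ
      · exact (hm h1).trans (by linarith)
      · omega
      · exact le_rfl
    · simpa using h0
    · simp
    · intro i hi
      rcases Nat.lt_succ_iff_lt_or_eq.1 hi with h1 | rfl
      · obtain ⟨a, b, hab⟩ := hσ i h1
        refine ⟨a, b, fun t ht1 ht2 => ?_⟩
        dsimp only at ht1 ht2
        rw [if_pos h1.le] at ht1
        rw [if_pos (Nat.succ_le_of_lt h1)] at ht2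
        rw [e1 t (ht2.trans (hn ▸ hm h1)), hab t ht1 ht2]
      · refine ⟨p - τ • v, v, fun t ht1 ht2 => ?_⟩
        dsimp only at ht1
        rw [if_pos le_rfl, hn] at ht1
        rw [e2 t ht1, sub_smul]
        abel
    · have hd : Disjoint (Set.Ioc 0 τ) (Set.Ioc τ (τ + w)) :=
        Set.disjoint_left.2 fun t h1 h2 => absurd h1.2 (not_le.2 h2.1)
      rw [← Set.Ioc_union_Ioc_eq_Ioc hτ (by linarith : τ ≤ τ + w),
        lintegral_union measurableSet_Ioc hd]
      congr 1
      · rw [← hint, setLIntegral_congr Ioo_ae_eq_Ioc.symm, setLIntegral_congr Ioo_ae_eq_Ioc.symm]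
        refine setLIntegral_congr_fun measurableSet_Ioo fun t ht => ?_
        have : f' =ᶠ[𝓝 t] f := by
          filter_upwards [Iio_mem_nhds ht.2] with s hs using e1 s (le_of_lt hs)
        simp only [this.deriv_eq, this.eq_of_nhds]
      · rw [setLIntegral_segment L (p := p - τ • v) (v := v) (Λ := Λ)]
        · congr 2; ring
        · intro t ht
          rw [e2 t ht.1.le, sub_smul]
          abel
        · intro t ht
          rw [e2 t ht.1.le]
          exact (hΛ (t - τ) ⟨by linarith [ht.1], by linarith [ht.2]⟩).2

/-- Detours make chains last longer than `T`; cutting at `T` can only lower the cost. -/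
theorem exists_pathSpace (h : Reach L g ρ x τ p c) {T : ℝ} (hT : 0 < T) (hTτ : T ≤ τ) :
    ∃ ψ : PathSpace T N, ψ.IsPiecewiseLinear ∧ actionJ L ψ ≤ c ∧
      ∀ t : Set.Icc (0 : ℝ) T, ‖ψ.toFun t - g t‖ ≤ ρ := by
  obtain ⟨f, hf, -, -, hft, ⟨n, σ, hm, h0, hn, hσ⟩, hint⟩ := h.exists_function
  have hfc : Continuous fun t : Set.Icc (0 : ℝ) T => f t := hf.comp continuous_subtype_val
  let ψ : PathSpace T N :=
    { toFun := fun t => f t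
      mem_orthant := fun t => (hft t ⟨t.2.1, t.2.2.trans hTτ⟩).1
      cadlag := ⟨fun t => hfc.continuousWithinAt, fun t => ⟨f t,
        hfc.continuousAt.tendsto.mono_left nhdsWithin_le_nhds⟩⟩ }
  refine ⟨ψ, ⟨n, fun i => min (σ i) T, fun i j hij => min_le_min_right _ (hm hij), ?_, ?_, ?_⟩, ?_,
    fun t => (hft t ⟨t.2.1, t.2.2.trans hTτ⟩).2⟩
  · simp [h0, hT.le]
  · simp [hn, hTτ]
  · intro i hi
    obtain ⟨a, v, hav⟩ := hσ i hi
    dsimp only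
    rcases le_total (σ i) T with h1 | h1
    · refine ⟨a, v, fun t ht1 ht2 => hav t ?_ (ht2.trans (min_le_left _ _))⟩
      rwa [min_eq_left h1] at ht1
    -- Past `T` the truncated piece is the single point `T`, so a constant serves.
    · refine ⟨f T, 0, fun t ht1 ht2 => ?_⟩
      rw [min_eq_right h1] at ht1
      have : (t : ℝ) = T := le_antisymm t.2.2 ht1
      simp [ψ, this]
  · rw [← hint]
    unfold actionJ
    rw [← setLIntegral_congr Ioo_ae_eq_Icc]
    refine le_trans (le_of_eq ?_) (lintegral_mono_set (s := Set.Ioo 0 T)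
      fun t ht => ⟨ht.1, ht.2.le.trans hTτ⟩)
    refine setLIntegral_congr_fun measurableSet_Ioo fun t ht => ?_
    have : ψ.ext =ᶠ[𝓝 t] f := by
      filter_upwards [Ioo_mem_nhds ht.1 ht.2] with s hs
      exact ψ.ext_apply ⟨s, hs.1.le, hs.2.le⟩
    simp only [this.deriv_eq, this.eq_of_nhds]

end Reach

/-! ### Detours through the interior of the orthant -/

theorem exists_add_eq_of_add_lt_ofReal {a b : ℝ≥0∞} {c : ℝ} (h : a + b < ENNReal.ofReal c) :
    ∃ c₁ c₂ : ℝ, a < ENNReal.ofReal c₁ ∧ b < ENNReal.ofReal c₂ ∧ c₁ + c₂ = c := by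
  have ha : a ≠ ⊤ := (lt_of_le_of_lt le_self_add (h.trans ENNReal.ofReal_lt_top)).ne
  have hb : b ≠ ⊤ := (lt_of_le_of_lt le_add_self (h.trans ENNReal.ofReal_lt_top)).ne
  lift a to ℝ≥0 using ha
  lift b to ℝ≥0 using hb
  have key : ∀ (a : ℝ≥0) (c : ℝ), (a : ℝ≥0∞) < ENNReal.ofReal c ↔ (a : ℝ) < c := fun a c =>
    ENNReal.lt_ofReal_iff_toReal_lt ENNReal.coe_ne_top
  rw [← ENNReal.coe_add, key, NNReal.coe_add] at h
  refine ⟨a + (c - a - b) / 2, b + (c - a - b) / 2, (key _ _).2 ?_, (key _ _).2 ?_, by ring⟩ <;>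
    linarith

/-- A finite convex function on an open ball in finite dimension is continuous, hence bounded on a
smaller closed ball. -/
theorem AssumptionA2.exists_bound {N : ℕ} {L : Finset (Fin N) → RN N → ℝ≥0∞}
    (hconvex : ConvexOn ℝ≥0 Set.univ (L Finset.univ)) (hA2 : AssumptionA2 L) :
    ∃ r > 0, ∃ C : ℝ≥0, ∀ v, ‖v‖ ≤ r → L Finset.univ v ≤ C := by
  obtain ⟨R, hR, h⟩ := Metric.eventually_nhds_iff_ball.1 hA2
  have hcv : ConvexOn ℝ (Metric.ball (0 : RN N) R) fun v => (L Finset.univ v).toReal := by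
    refine ⟨convex_ball _ _, fun x hx y hy a b ha hb hab => ?_⟩
    lift a to ℝ≥0 using ha
    lift b to ℝ≥0 using hb
    have h1 := hconvex.2 (Set.mem_univ x) (Set.mem_univ y) (zero_le (a := a)) (zero_le (a := b))
      (by exact_mod_cast hab)
    have h2 := ENNReal.toReal_mono (ENNReal.add_ne_top.2
      ⟨ENNReal.mul_ne_top ENNReal.coe_ne_top (h x hx).ne,
        ENNReal.mul_ne_top ENNReal.coe_ne_top (h y hy).ne⟩) h1
    rw [ENNReal.toReal_add (ENNReal.mul_ne_top ENNReal.coe_ne_top (h x hx).ne)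
      (ENNReal.mul_ne_top ENNReal.coe_ne_top (h y hy).ne)] at h2
    simp only [ENNReal.toReal_mul, ENNReal.coe_toReal] at h2
    exact h2
  have hsub : Metric.closedBall (0 : RN N) (R / 2) ⊆ Metric.ball 0 R :=
    Metric.closedBall_subset_ball (half_lt_self hR)
  obtain ⟨B, hB⟩ := (isCompact_closedBall (0 : RN N) (R / 2)).bddAbove_image
    ((hcv.continuousOn Metric.isOpen_ball).mono hsub)
  refine ⟨R / 2, half_pos hR, B.toNNReal, fun v hv => ?_⟩
  have hv' : v ∈ Metric.closedBall (0 : RN N) (R / 2) := by simpa using hv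
  rw [← ENNReal.ofReal_toReal (h v (hsub hv')).ne]
  exact ENNReal.ofReal_le_ofReal (hB ⟨v, hv', rfl⟩)

theorem mem_face_univ_iff {N : ℕ} {x : RN N} : x ∈ face Finset.univ ↔ ∀ i, 0 < x i := by
  have h : posSet x = Finset.univ ↔ ∀ i, 0 < x i := by simp [posSet, Finset.filter_eq_self]
  exact ⟨fun hx => h.1 hx.2, fun hx => ⟨fun i => (hx i).le, h.2 hx⟩⟩

namespace Reach

variable {N : ℕ} {L : Finset (Fin N) → RN N → ℝ≥0∞} {g : ℝ → RN N} {ρ : ℝ} {x : RN N} {τ : ℝ}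
  {p : RN N} {c : ℝ≥0∞}

/-- If one endpoint has only positive coordinates, so has every interior point of the segment, which
is therefore charged with `L Finset.univ` at a speed of at most `r`. -/
theorem step_interior (hR : Reach L g ρ x τ p c) {r : ℝ} {C : ℝ≥0}
    (hC : ∀ v, ‖v‖ ≤ r → L Finset.univ v ≤ C) {q : RN N} (hq : q ∈ orthant N)
    (hpq : (∀ i, 0 < p i) ∨ ∀ i, 0 < q i) {h : ℝ} (hh : 0 < h) (hd : ‖q - p‖ ≤ r * h)
    (hg : ∀ t ∈ Set.Icc (0 : ℝ) h, ‖p - g (τ + t)‖ + r * h ≤ ρ) :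
    ∃ c' ≤ c + ENNReal.ofReal h * C, Reach L g ρ x (τ + h) q c' := by
  have hp := hR.mem_orthant
  have e : p + h • (h⁻¹ • (q - p)) = q := by
    rw [smul_inv_smul₀ hh.ne', add_sub_cancel]
  have ec : ∀ (t : ℝ) (i : Fin N), (p + t • (h⁻¹ • (q - p))) i = (1 - t / h) * p i + t / h * q i := by
    intro t i
    simp only [PiLp.add_apply, PiLp.smul_apply, PiLp.sub_apply, smul_eq_mul]
    ring
  refine ⟨c + ENNReal.ofReal h * L Finset.univ (h⁻¹ • (q - p)), ?_, ?_⟩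
  · gcongr
    refine hC _ ?_
    rw [norm_smul, norm_inv, Real.norm_of_nonneg hh.le, inv_mul_le_iff₀ hh]
    linarith
  · have H := hR.step (v := h⁻¹ • (q - p)) (Λ := Finset.univ) hh (fun t ht i => ?_)
      (fun t ht => mem_face_univ_iff.2 fun i => ?_) fun t ht => ?_
    · rwa [e] at H
    · rw [ec]
      have h1 : 0 ≤ t / h := div_nonneg ht.1 hh.le
      have h2 : t / h ≤ 1 := (div_le_one hh).2 ht.2
      exact add_nonneg (mul_nonneg (by linarith) (hp i)) (mul_nonneg h1 (hq i))
    · rw [ec]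
      have h1 : 0 < t / h := div_pos ht.1 hh
      have h2 : 0 < 1 - t / h := sub_pos.2 ((div_lt_one hh).2 ht.2)
      rcases hpq with h3 | h3
      · exact add_pos_of_pos_of_nonneg (mul_pos h2 (h3 i)) (mul_nonneg h1.le (hq i))
      · exact add_pos_of_nonneg_of_pos (mul_nonneg h2.le (hp i)) (mul_pos h1 (h3 i))
    · have h1 : ‖t • (h⁻¹ • (q - p))‖ ≤ r * h := by
        rw [norm_smul, norm_smul, norm_inv, Real.norm_of_nonneg hh.le, Real.norm_of_nonneg ht.1,
          ← mul_assoc]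
        have : t * h⁻¹ ≤ 1 := (div_le_one hh).2 ht.2
        exact (mul_le_of_le_one_left (norm_nonneg _) this).trans hd
      calc ‖p + t • (h⁻¹ • (q - p)) - g (τ + t)‖ = ‖(p - g (τ + t)) + t • (h⁻¹ • (q - p))‖ := by
            congr 1; abel
        _ ≤ _ := norm_add_le _ _
        _ ≤ ρ := by linarith [hg t ht]

/-- A connection through the interior of the orthant. -/
theorem detour (hR : Reach L g ρ x τ p c) {r : ℝ} {C : ℝ≥0}
    (hC : ∀ v, ‖v‖ ≤ r → L Finset.univ v ≤ C) {q : RN N} (hq : q ∈ orthant N)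
    {w : ℝ} (hw : 0 < w) (hd : ‖q - p‖ < r * w)
    (hg : ∀ t ∈ Set.Icc (0 : ℝ) w, ‖p - g (τ + t)‖ + r * w ≤ ρ) :
    ∃ c' ≤ c + ENNReal.ofReal w * C, Reach L g ρ x (τ + w) q c' := by
  have hp := hR.mem_orthant
  let e : RN N := WithLp.toLp 2 fun _ => (1 : ℝ)
  -- The strict bound `hd` leaves room to push the midpoint of `p` and `q` into the interior by `γ •
  -- e`, keeping it within `r * w / 2` of both. The summand `1` avoids division by zero when `N =
  -- 0`.
  obtain ⟨γ, hγ, hγe⟩ : ∃ γ > 0, γ * (‖e‖ + 1) = (r * w - ‖q - p‖) / 2 :=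
    ⟨(r * w - ‖q - p‖) / 2 / (‖e‖ + 1), by have := norm_nonneg e; have := sub_pos.2 hd; positivity,
      div_mul_cancel₀ _ (by positivity)⟩
  have hγ' : γ * ‖e‖ ≤ (r * w - ‖q - p‖) / 2 := by nlinarith
  have hne : ‖γ • e‖ = γ * ‖e‖ := by rw [norm_smul, Real.norm_of_nonneg hγ.le]
  have hn2 : ‖(2⁻¹ : ℝ) • (q - p)‖ = ‖q - p‖ / 2 := by
    rw [norm_smul, norm_inv, Real.norm_ofNat]; ring
  let m : RN N := p + ((2⁻¹ : ℝ) • (q - p) + γ • e)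
  have hm : ∀ i, 0 < m i := by
    intro i
    have : m i = p i / 2 + q i / 2 + γ := by
      simp only [m, e, PiLp.add_apply, PiLp.smul_apply, PiLp.sub_apply, smul_eq_mul]
      ring
    rw [this]
    have := hp i
    have := hq i
    positivity
  have hmp : ‖m - p‖ ≤ r * (w / 2) := by
    rw [add_sub_cancel_left]
    refine (norm_add_le _ _).trans ?_
    rw [hne, hn2]
    linarith
  have hqm : ‖q - m‖ ≤ r * (w / 2) := by
    have : q - m = (2⁻¹ : ℝ) • (q - p) - γ • e := by
      simp only [m]
      module
    rw [this]
    refine (norm_sub_le _ _).trans ?_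
    rw [hne, hn2]
    linarith
  have hrw : 0 ≤ r * w := (norm_nonneg _).trans hd.le
  obtain ⟨c₁, hc₁, h1⟩ := hR.step_interior hC (fun i => (hm i).le) (Or.inr hm) (half_pos hw) hmp
    fun t ht => by linarith [hg t ⟨ht.1, by linarith [ht.2]⟩]
  obtain ⟨c₂, hc₂, h2⟩ := h1.step_interior hC hq (Or.inl hm) (half_pos hw) hqm fun t ht => by
    have h3 := hg (w / 2 + t) ⟨by linarith [ht.1], by linarith [ht.2]⟩
    rw [← add_assoc] at h3
    have h4 := norm_sub_le_norm_sub_add_norm_sub m p (g (τ + w / 2 + t))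
    linarith
  rw [add_assoc, add_halves] at h2
  refine ⟨c₂, hc₂.trans ((add_le_add_left hc₁ _).trans (le_of_eq ?_)), h2⟩
  rw [add_assoc, ← add_mul, ← ENNReal.ofReal_add (half_pos hw).le (half_pos hw).le, add_halves]

/-- A chain can be prolonged along a piecewise linear path. -/
theorem follow {T : ℝ} {ψ : PathSpace T N} (hψ : ψ.IsPiecewiseLinear)
    (hR : Reach L g ρ x τ (ψ.ext 0) c) (hg : ∀ t ∈ Set.Icc 0 T, ‖ψ.ext t - g (τ + t)‖ ≤ ρ) :
    Reach L g ρ x (τ + T) (ψ.ext T) (c + actionJ L ψ) := by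
  obtain ⟨n, σ, hm, h0, hn, hσ⟩ := hψ
  have key : ∀ k ≤ n, Reach L g ρ x (τ + σ k) (ψ.ext (σ k))
      (c + ∫⁻ t in Set.Ioc 0 (σ k), L (posSet (ψ.ext t)) (deriv ψ.ext t)) := by
    intro k
    induction k with
    | zero => intro _; simpa [h0] using hR
    | succ k ih =>
      intro hk
      have hσ0 : 0 ≤ σ k := h0 ▸ hm (Nat.zero_le _)
      have hσT : σ (k + 1) ≤ T := hn ▸ hm hk
      -- Breakpoints may coincide, whereas a step of a chain has positive length.
      rcases (hm k.le_succ).eq_or_lt with he | hlt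
      · rw [← he]; exact ih (by omega)
      have ih := ih (by omega)
      obtain ⟨a, v, hav⟩ := hσ k (by omega)
      have hext : ∀ t, σ k ≤ t → t ≤ σ (k + 1) → ψ.ext t = a + t • v := fun t h1 h2 =>
        (ψ.ext_apply ⟨t, hσ0.trans h1, h2.trans hσT⟩).trans (hav ⟨t, hσ0.trans h1, h2.trans hσT⟩ h1 h2)
      have hp : ∀ t ∈ Set.Icc 0 (σ (k + 1) - σ k), ψ.ext (σ k) + t • v = ψ.ext (σ k + t) := by
        intro t ht
        rw [hext _ le_rfl hlt.le, hext _ (by linarith [ht.1]) (by linarith [ht.2]), add_smul,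
          add_assoc]
      have ho : ∀ t ∈ Set.Icc 0 (σ (k + 1) - σ k), ψ.ext (σ k) + t • v ∈ orthant N := by
        intro t ht
        rw [hp t ht]
        have := ψ.ext_apply ⟨σ k + t, by linarith [ht.1], by linarith [ht.2]⟩
        rw [this]
        exact ψ.mem_orthant _
      obtain ⟨Λ, hΛ⟩ := exists_face_of_segment ho
      have := ih.step (sub_pos.2 hlt) ho hΛ fun t ht => by
        rw [hp t ht, add_assoc]
        exact hg _ ⟨by linarith [ht.1], by linarith [ht.2]⟩
      rw [hp _ ⟨(sub_pos.2 hlt).le, le_rfl⟩, add_assoc τ, add_sub_cancel] at this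
      convert this using 1
      rw [add_assoc, ← setLIntegral_segment L (f := ψ.ext) (p := a) (v := v) (Λ := Λ)
        (fun t ht => hext t ht.1.le ht.2.le), ← Set.Ioc_union_Ioc_eq_Ioc hσ0 hlt.le,
        lintegral_union measurableSet_Ioc
          (Set.disjoint_left.2 fun t h1 h2 => absurd h1.2 (not_le.2 h2.1))]
      intro t ht
      have h1 := hp (t - σ k) ⟨by linarith [ht.1], by linarith [ht.2]⟩
      rw [add_sub_cancel] at h1
      rw [← h1]
      exact (hΛ _ ⟨by linarith [ht.1], by linarith [ht.2]⟩).2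
  have := key n le_rfl
  rwa [hn, setLIntegral_congr Ioc_ae_eq_Icc] at this

end Reach

/-! ### Lower bounds along chains -/

namespace MarkovProcess

variable {N : ℕ} {S : Set (RN N)} {Ω : Type*} [MeasurableSpace Ω]

theorem tubeEvent_subset_closedTube (M : MarkovProcess S Ω) (T : ℝ) (f : ℝ → RN N) {δ δ' : ℝ}
    (h0 : 0 ≤ δ) (h : δ ≤ δ') (n : ℕ) : M.tubeEvent T f δ n ⊆ M.closedTube n f 0 T δ' := by
  intro ω hω t ht1 ht2
  have h1 : edist (f t) (M.Z n (Real.toNNReal t) ω) < ENNReal.ofReal δ :=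
    (le_iSup (fun t : Set.Icc (0 : ℝ) T => edist (f t) (M.Z n (Real.toNNReal t) ω))
      ⟨t, ht1, ht2⟩).trans_lt hω
  have h2 := h1.le
  rw [edist_dist, ENNReal.ofReal_le_ofReal_iff h0, dist_comm, dist_eq_norm] at h2
  rw [zero_add]
  exact h2.trans h

theorem AssumptionA1.expLower {M : MarkovProcess S Ω} {L : Finset (Fin N) → RN N → ℝ≥0∞}
    (hA1 : M.AssumptionA1 L) {Λ : Finset (Fin N)} {w : ℝ} (hw : 0 < w) {p v : RN N}
    (ho : ∀ t ∈ Set.Icc (0 : ℝ) w, p + t • v ∈ orthant N)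
    (hΛ : ∀ t ∈ Set.Ioo (0 : ℝ) w, p + t • v ∈ face Λ) {c : ℝ}
    (hc : ENNReal.ofReal w * L Λ v < ENNReal.ofReal c) {δ : ℝ} (hδ : 0 < δ) :
    M.ExpLower p (fun n => M.closedTube n (fun t => p + t • v) 0 w δ) c := by
  have hc0 : 0 < c := ENNReal.ofReal_pos.1 (bot_le.trans_lt hc)
  have h1 : ((-c : ℝ) : EReal) < -((ENNReal.ofReal w * L Λ v : ℝ≥0∞) : EReal) := by
    rw [EReal.coe_neg, EReal.neg_lt_neg_iff, ← max_eq_left hc0.le, ← EReal.coe_ennreal_ofReal]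
    exact EReal.coe_ennreal_lt_coe_ennreal_iff.2 hc
  obtain ⟨δ', h2, h3⟩ := ((eventually_lt_of_lt_liminf (h1.trans_le (hA1 Λ w hw p v ho hΛ))).and
    (Ioo_mem_nhdsGT hδ)).exists
  exact (expLower_of_lt_liminf h2).mono
    (fun n => M.tubeEvent_subset_closedTube w _ h3.1.le h3.2.le n) le_rfl

end MarkovProcess

/-- By induction along the chain: the constraint on the endpoint places `Z_n(τ)` where the estimate
of (A1) for the next segment holds, and the two probabilities multiply. All `δ` are treated at once
because each segment dictates how precisely the preceding ones must end. -/
theorem Reach.expLower {N : ℕ} {S : Set (RN N)} {Ω : Type*} [MeasurableSpace Ω]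
    {M : MarkovProcess S Ω} {L : Finset (Fin N) → RN N → ℝ≥0∞} (hA1 : M.AssumptionA1 L)
    {g : ℝ → RN N} (hgc : Continuous g) {ρ : ℝ} {x : RN N} {τ : ℝ} {p : RN N} {c : ℝ≥0∞}
    (h : Reach L g ρ x τ p c) : ∀ {δ : ℝ}, 0 < δ → ∀ {c' : ℝ}, c < ENNReal.ofReal c' →
      M.ExpLower x (fun n => M.closedTube n g 0 τ (ρ + δ) ∩ {ω | ‖M.Z n τ.toNNReal ω - p‖ ≤ δ})
        c' := by
  induction h with
  | start hx hg =>
    intro δ hδ c' hc'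
    have hc0 : 0 < c' := ENNReal.ofReal_pos.1 hc'
    refine ⟨δ, hδ, ?_⟩
    filter_upwards [eventually_ge_atTop 1] with n hn z hz
    have hP := M.isProbabilityMeasure_scaledLaw n z
    have hn' : (n : ℝ) ≠ 0 := by positivity
    have h0 : ∀ᵐ ω ∂(M.scaledLaw n z), M.Z n 0 ω = z := by
      filter_upwards [M.start ⟨(n : ℝ) • (z : RN N), z.2⟩] with ω hω
      simp [MarkovProcess.Z, hω, inv_smul_smul₀ hn']
    -- At time `0` the event has full probability.
    refine le_trans ?_ (measure_mono_ae (s := Set.univ) ?_)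
    · rw [measure_univ, ENNReal.ofReal_le_one, Real.exp_le_one_iff]
      have : 0 ≤ n * c' := by positivity
      linarith
    · filter_upwards [h0] with ω hω _
      refine ⟨fun t ht0 ht => ?_, ?_⟩
      · obtain rfl : t = 0 := le_antisymm ht ht0
        rw [Real.toNNReal_zero, zero_add, hω]
        have := norm_sub_le_norm_sub_add_norm_sub (z : RN N) x (g 0)
        linarith
      · simpa [hω] using hz.le
  | @step τ p c h w hw v Λ ho hΛ hg ih =>
    intro δ hδ c' hc'
    obtain ⟨c₁, c₂, hc₁, hc₂, rfl⟩ := exists_add_eq_of_add_lt_ofReal hc'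
    obtain ⟨ε₂, hε₂, h2⟩ := hA1.expLower hw ho hΛ hc₂ hδ
    -- Tubes are closed and (A1) is available on an open ball of radius `ε₂`, hence the half.
    have hδ₁ : 0 < min δ (ε₂ / 2) := lt_min hδ (half_pos hε₂)
    obtain ⟨ε₁, hε₁, h1⟩ := ih hδ₁ hc₁
    refine ⟨ε₁, hε₁, ?_⟩
    filter_upwards [h1, h2, eventually_ge_atTop 1] with n h1 h2 hn z hz
    have hτ := h.time_nonneg
    have hA : MeasurableSet[M.past (n * τ.toNNReal)] (M.closedTube n g 0 τ (ρ + min δ (ε₂ / 2)) ∩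
        {ω | ‖M.Z n τ.toNNReal ω - p‖ ≤ min δ (ε₂ / 2)}) :=
      (M.measurableSet_closedTube n hgc hτ _).inter (M.measurableSet_past_Z n p _ _)
    have h3 := M.mul_le_scaledLaw_inter hn z (f := fun t => p + t • v) (by fun_prop) τ.toNNReal hw.le
      δ hA (p := p) (ε := ε₂) (fun ω hω => hω.2.trans_lt ((min_le_right _ _).trans_lt
        (half_lt_self hε₂))) h2
    calc ENNReal.ofReal (Real.exp (-(n * (c₁ + c₂)))) =
        ENNReal.ofReal (Real.exp (-(n * c₂))) * ENNReal.ofReal (Real.exp (-(n * c₁))) := by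
          rw [← ENNReal.ofReal_mul (Real.exp_pos _).le, ← Real.exp_add]; congr 2; ring
      _ ≤ _ := mul_le_mul_right (h1 z hz) _
      _ ≤ _ := h3
      _ ≤ _ := by
        refine measure_mono ?_
        rintro ω ⟨⟨ha, hb⟩, hc⟩
        have hZ : ∀ t, 0 ≤ t → t ≤ w → ‖M.Z n (τ + t).toNNReal ω - (p + t • v)‖ ≤ δ := by
          intro t ht0 ht
          rw [Real.toNNReal_add hτ ht0]
          exact hc t ht0 ht
        refine ⟨fun t ht0 ht => ?_, hZ w hw.le le_rfl⟩
        rw [zero_add]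
        rcases le_total t τ with h4 | h4
        · have := ha t ht0 h4
          rw [zero_add] at this
          exact this.trans (add_le_add_right (min_le_left _ _) _)
        · have h5 := hZ (t - τ) (by linarith) (by linarith)
          have h6 := hg (t - τ) ⟨by linarith, by linarith⟩
          rw [add_sub_cancel] at h5 h6
          have := norm_sub_le_norm_sub_add_norm_sub (M.Z n t.toNNReal ω) (p + (t - τ) • v) (g t)
          linarith

/-! ### The local lower bound -/

/-- Chains run beyond time `T` and need a reference path there; the path is continued by constants.
-/
theorem PathSpace.exists_uniformContinuous_extension {T : ℝ} {N : ℕ} (hT : 0 ≤ T)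
    {φ : PathSpace T N} (hφ : Continuous φ.toFun) :
    ∃ g : ℝ → RN N, UniformContinuous g ∧ ∀ t ∈ Set.Icc 0 T, g t = φ.ext t := by
  refine ⟨fun t => φ.toFun (Set.projIcc 0 T hT t),
    (CompactSpace.uniformContinuous_of_continuous hφ).comp
      (LipschitzWith.projIcc hT).uniformContinuous, fun t ht => ?_⟩
  simp only [Set.projIcc_of_mem hT ht, ← φ.ext_apply]

namespace MarkovProcess

variable {N : ℕ} {S : Set (RN N)} {Ω : Type*} [MeasurableSpace Ω] {T : ℝ}

/-- A detour of duration `w` from `φ(0)` to `ψ(0)`, followed by `ψ` delayed by `w`, costs at most `w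
* C` more than `ψ`. -/
theorem expLower_of_rateI_lt {M : MarkovProcess S Ω} {L : Finset (Fin N) → RN N → ℝ≥0∞}
    (hconvex : ConvexOn ℝ≥0 Set.univ (L Finset.univ)) (hA1 : M.AssumptionA1 L)
    (hA2 : AssumptionA2 L) (hT : 0 < T) {O : Set (PathSpace T N)} (hO : IsOpen O)
    {φ : PathSpace T N} (hφO : φ ∈ O) {c : ℝ} (hc : rateI L T φ < ENNReal.ofReal c) :
    M.ExpLower (φ.ext 0) (fun n => {ω | M.scaledPath n T ω ∈ O}) c := by
  have h0T : (0 : ℝ) ∈ Set.Icc 0 T := ⟨le_rfl, hT.le⟩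
  have hφ : Continuous φ.toFun := PathSpace.continuous_toFun_of_approx fun r hr => by
    obtain ⟨ψ, h1, h2, -⟩ := exists_isPiecewiseLinear_of_rateI_lt hc hr
    exact ⟨ψ, PathSpace.continuous_toFun_iff.2 h1.continuousOn_ext, h2⟩
  obtain ⟨g, hgu, hg⟩ := PathSpace.exists_uniformContinuous_extension hT.le hφ
  obtain ⟨r, hr, C, hC⟩ := hA2.exists_bound hconvex
  obtain ⟨ε, hε, hball⟩ := EMetric.isOpen_iff.1 hO φ hφO
  obtain ⟨ρ, hρ, hρε⟩ : ∃ ρ : ℝ, 0 < ρ ∧ ENNReal.ofReal ρ < ε := by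
    obtain ⟨ρ, h1, h2⟩ := ENNReal.lt_iff_exists_nnreal_btwn.1 hε
    exact ⟨ρ, by exact_mod_cast h1, by simpa using h2⟩
  obtain ⟨η, hη, hmod⟩ := Metric.uniformContinuous_iff.1 hgu (ρ / 8) (by positivity)
  obtain ⟨c₁, h1, h2⟩ := exists_between hc
  -- The duration `w` is small in three respects: its cost fits between `c₁` and `c`, it moves `g`
  -- by at most `ρ / 8`, and the detour strays by at most `r * w ≤ ρ / 8`.
  have hlim : Tendsto (fun w : ℝ => c₁ + ENNReal.ofReal w * C) (𝓝[>] 0) (𝓝 (c₁ + 0 * C)) := by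
    refine Tendsto.const_add _ (ENNReal.Tendsto.mul_const ?_ (Or.inr ENNReal.coe_ne_top))
    rw [← ENNReal.ofReal_zero]
    exact (ENNReal.continuous_ofReal.tendsto 0).mono_left nhdsWithin_le_nhds
  rw [zero_mul, add_zero] at hlim
  have hb : 0 < min η (ρ / (8 * r)) := lt_min hη (by positivity)
  obtain ⟨w, hwc, hw0, hw⟩ := ((hlim.eventually (gt_mem_nhds h2)).and
    (Ioo_mem_nhdsGT hb)).exists
  have hwη : w < η := hw.trans_le (min_le_left _ _)
  have hrw : r * w ≤ ρ / 8 := by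
    have := (hw.trans_le (min_le_right _ _)).le
    rw [le_div_iff₀ (by positivity)] at this
    linarith
  -- `ψ` is chosen after `w`, so close to `φ` that `ψ(0)` is within reach of a detour of duration
  -- `w`.
  obtain ⟨δ, hδ, hδ'⟩ := PathSpace.exists_forall_norm_sub_le hφ
    (lt_min (by positivity : 0 < ρ / 8) (by positivity : 0 < r * w / 2))
  obtain ⟨ψ, hψ, hd, hJ⟩ := exists_isPiecewiseLinear_of_rateI_lt h1 hδ
  have hψφ : ∀ t ∈ Set.Icc 0 T, ‖ψ.ext t - φ.ext t‖ ≤ min (ρ / 8) (r * w / 2) := by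
    intro t ht
    have := hδ' ψ hd ⟨t, ht⟩
    rwa [← PathSpace.ext_apply, ← PathSpace.ext_apply] at this
  have hψo : ψ.ext 0 ∈ orthant N := ψ.ext_apply ⟨0, h0T⟩ ▸ ψ.mem_orthant _
  have hφo : φ.ext 0 ∈ orthant N := φ.ext_apply ⟨0, h0T⟩ ▸ φ.mem_orthant _
  have hmod' : ∀ s t, |s - t| ≤ w → ‖g s - g t‖ ≤ ρ / 8 := fun s t h => by
    rw [← dist_eq_norm]
    exact (hmod (by rw [Real.dist_eq]; exact h.trans_lt hwη)).le
  have start : Reach L g (ρ / 2) (φ.ext 0) 0 (φ.ext 0) 0 :=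
    .start hφo (by rw [hg 0 h0T, sub_self, norm_zero]; positivity)
  obtain ⟨c₂, hc₂, hR⟩ := start.detour hC hψo hw0
    ((hψφ 0 h0T).trans_lt ((min_le_right _ _).trans_lt (half_lt_self (by positivity))))
    fun t ht => by
      have := hmod' 0 (0 + t) (by rw [abs_sub_comm, abs_le]; constructor <;> linarith [ht.1, ht.2])
      rw [hg 0 h0T] at this
      linarith
  have hR' := hR.follow hψ fun t ht => by
    have h3 := hmod' t (0 + w + t) (by
      rw [abs_sub_comm, abs_le]; constructor <;> linarith [hw0])
    have h4 := (hψφ t ht).trans (min_le_left _ _)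
    rw [← hg t ht] at h4
    have := norm_sub_le_norm_sub_add_norm_sub (ψ.ext t) (g t) (g (0 + w + t))
    linarith
  have hcost : c₂ + actionJ L ψ < ENNReal.ofReal c := by
    refine lt_of_le_of_lt ?_ hwc
    rw [add_comm]
    exact add_le_add hJ.le (hc₂.trans (by simp))
  refine (hR'.expLower hA1 hgu.continuous (half_pos hρ) hcost).mono (fun n ω hω => ?_) le_rfl
  refine hball ?_
  rw [Metric.mem_eball, edist_comm]
  refine (PathSpace.edist_le_of_forall (r := ENNReal.ofReal ρ) fun t => ?_).trans_lt hρε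
  have h3 := hω.1 t t.2.1 (by linarith [t.2.2])
  rw [zero_add, add_halves, hg t t.2, PathSpace.ext_apply] at h3
  rw [edist_comm, edist_dist, dist_eq_norm]
  exact ENNReal.ofReal_le_ofReal h3

/-! ### From exponential estimates to large deviation bounds, and goodness -/

theorem lowerLDBound_of_expLower {M : MarkovProcess S Ω} {I : PathSpace T N → ℝ≥0∞}
    (h : ∀ O : Set (PathSpace T N), IsOpen O → ∀ φ ∈ O, ∀ c : ℝ, I φ < ENNReal.ofReal c →
      M.ExpLower (φ.ext 0) (fun n => {ω | M.scaledPath n T ω ∈ O}) c) :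
    M.LowerLDBound T I := by
  intro x _ O hO
  refine le_of_forall_lt fun b hb => ?_
  obtain ⟨d, hbd, hd⟩ := EReal.lt_iff_exists_real_btwn.1 hb
  rw [EReal.lt_neg_comm, ← EReal.coe_neg] at hd
  have hd' := hd.trans_le (show ((-d : ℝ) : EReal) ≤ ((ENNReal.ofReal (-d) : ℝ≥0∞) : EReal) by
    rw [EReal.coe_ennreal_ofReal]; exact EReal.coe_le_coe_iff.2 (le_max_left _ _))
  rw [EReal.coe_ennreal_lt_coe_ennreal_iff] at hd'
  simp only [iInf_lt_iff] at hd'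
  obtain ⟨φ, hφ, rfl, hφI⟩ := hd'
  have := (h O hO φ hφ _ hφI).le_liminf
  rw [neg_neg] at this
  exact hbd.trans_le this

theorem upperLDBound_of_expUpper {M : MarkovProcess S Ω} {I : PathSpace T N → ℝ≥0∞}
    (h : ∀ x ∈ orthant N, ∀ F : Set (PathSpace T N), IsClosed F → ∀ c : ℝ,
      (c : EReal) < ((⨅ (φ : PathSpace T N) (_ : φ ∈ F) (_ : φ.ext 0 = x), I φ : ℝ≥0∞) : EReal) →
      M.ExpUpper x (fun n => {ω | M.scaledPath n T ω ∈ F}) c) :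
    M.UpperLDBound T I := by
  intro x hx F hF
  refine le_of_forall_gt fun b hb => ?_
  obtain ⟨d, hd, hbd⟩ := EReal.lt_iff_exists_real_btwn.1 hb
  rw [EReal.neg_lt_comm, ← EReal.coe_neg] at hd
  have := (h x hx F hF _ hd).limsup_le
  rw [neg_neg] at this
  exact this.trans_lt hbd

theorem UpperLDBound.expUpper {M : MarkovProcess S Ω} {I : PathSpace T N → ℝ≥0∞}
    (h : M.UpperLDBound T I) {x : RN N} (hx : x ∈ orthant N) {F : Set (PathSpace T N)}
    (hF : IsClosed F) {c : ℝ}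
    (hc : (c : EReal) <
      ((⨅ (φ : PathSpace T N) (_ : φ ∈ F) (_ : φ.ext 0 = x), I φ : ℝ≥0∞) : EReal)) :
    M.ExpUpper x (fun n => {ω | M.scaledPath n T ω ∈ F}) c :=
  expUpper_of_limsup_lt ((h x hx F hF).trans_lt (by rwa [EReal.coe_neg, EReal.neg_lt_neg_iff]))

/-- The approximating states supply a starting point at which both bounds hold; without one, both
could be vacuous. -/
theorem ExpUpper.le_of_expLower {M : MarkovProcess S Ω} {x : RN N}
    (hx : ∃ u : ℕ → RN N, (∀ n, 1 ≤ n → u n ∈ scaledStates S n) ∧ Tendsto u atTop (𝓝 x))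
    {A : ℕ → Set Ω} {c d : ℝ} (hU : M.ExpUpper x A d) (hL : M.ExpLower x A c) : d ≤ c := by
  obtain ⟨u, hu, hux⟩ := hx
  obtain ⟨ε, hε, hU⟩ := hU
  obtain ⟨ε', hε', hL⟩ := hL
  obtain ⟨n, h1, h2, h3, h4⟩ := (hU.and (hL.and ((eventually_ge_atTop 1).and
    (Metric.tendsto_nhds.1 hux (min ε ε') (lt_min hε hε'))))).exists
  rw [dist_eq_norm, lt_min_iff] at h4
  have := (h2 ⟨u n, hu n h3⟩ h4.2).trans (h1 ⟨u n, hu n h3⟩ h4.1)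
  rw [ENNReal.ofReal_le_ofReal_iff (Real.exp_pos _).le, Real.exp_le_exp, neg_le_neg_iff] at this
  exact le_of_mul_le_mul_left this (by exact_mod_cast h3)

end MarkovProcess

theorem PathSpace.isClosed_setOf_ext_zero_mem {T : ℝ} {N : ℕ} (hT : 0 ≤ T) {V : Set (RN N)}
    (hV : IsClosed V) : IsClosed {φ : PathSpace T N | φ.ext 0 ∈ V} :=
  hV.preimage (PathSpace.continuous_ext_zero hT)

/-- A lower semicontinuous function that governs a lower bound inherits goodness from any good rate
function that governs an upper bound. -/
theorem IsGoodRateFunction.of_lower {N : ℕ} {S : Set (RN N)} {Ω : Type*} [MeasurableSpace Ω]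
    {M : MarkovProcess S Ω} {T : ℝ} (hT : 0 ≤ T)
    (hdense : ∀ x ∈ orthant N, ∃ u : ℕ → RN N,
      (∀ n, 1 ≤ n → u n ∈ scaledStates S n) ∧ Tendsto u atTop (𝓝 x))
    {I I' : PathSpace T N → ℝ≥0∞} (hgood : IsGoodRateFunction I') (hupper : M.UpperLDBound T I')
    (hlsc : LowerSemicontinuous I)
    (hlower : ∀ O : Set (PathSpace T N), IsOpen O → ∀ φ ∈ O, ∀ c : ℝ, I φ < ENNReal.ofReal c →
      M.ExpLower (φ.ext 0) (fun n => {ω | M.scaledPath n T ω ∈ O}) c) :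
    IsGoodRateFunction I := by
  have horth : ∀ φ : PathSpace T N, φ.ext 0 ∈ orthant N := fun φ =>
    φ.ext_apply ⟨0, le_rfl, hT⟩ ▸ φ.mem_orthant _
  -- Otherwise `I'` is at least `c + 1` on a closed ball around `φ`, among paths with the same
  -- starting point. The ball then decays at rate `c + 1/2` from above, while the lower bound gives
  -- `c + 1/4`.
  have key : ∀ (V : Set (RN N)) (c : ℝ≥0), {φ : PathSpace T N | φ.ext 0 ∈ V ∧ I φ ≤ c} ⊆
      closure {φ | φ.ext 0 ∈ V ∧ I' φ ≤ (c + 1 : ℝ≥0)} := by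
    rintro V c φ ⟨hφV, hφ⟩
    rw [EMetric.mem_closure_iff]
    intro ε hε
    obtain ⟨r, hr0, hr⟩ := exists_between hε
    by_contra! H
    have hlow := hlower _ Metric.isOpen_eball φ (Metric.mem_eball_self hr0) (c + 1 / 4) (by
      refine hφ.trans_lt ?_
      rw [← ENNReal.ofReal_coe_nnreal]
      exact (ENNReal.ofReal_lt_ofReal_iff (by positivity)).2 (by linarith))
    have hup := hupper.expUpper (horth φ) (F := Metric.closedEBall φ r) (c := c + 1 / 2)
      Metric.isClosed_closedEBall (by
        have h1 : ((c + 1 : ℝ≥0) : ℝ≥0∞) ≤ ⨅ (χ : PathSpace T N) (_ : χ ∈ Metric.closedEBall φ r)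
            (_ : χ.ext 0 = φ.ext 0), I' χ := by
          refine le_iInf fun χ => le_iInf₂ fun hχ hχ0 => ?_
          by_contra! hlt
          have := H χ ⟨hχ0 ▸ hφV, hlt.le⟩
          rw [edist_comm] at this
          exact absurd (this.trans hχ) (not_le.2 hr)
        refine lt_of_lt_of_le ?_ (EReal.coe_ennreal_le_coe_ennreal_iff.2 h1)
        rw [EReal.coe_nnreal_eq_coe_real, EReal.coe_lt_coe_iff, NNReal.coe_add, NNReal.coe_one]
        linarith)
    have := (hup.mono (fun n ω hω => Metric.eball_subset_closedEBall hω) le_rfl).le_of_expLower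
      (hdense _ (horth φ)) hlow
    linarith
  refine ⟨fun V hVo hV c hc => ?_, fun φ hφ => ?_⟩
  · refine (hgood.isCompact_level V hVo hV (c + 1) (by positivity)).closure.of_isClosed_subset ?_
      (key V c)
    exact (PathSpace.isClosed_setOf_ext_zero_mem hT hV.isClosed).inter (hlsc.isClosed_preimage c)
  · have hc : I φ ≤ (I φ).toNNReal := (ENNReal.coe_toNNReal hφ.ne).ge
    have h1 := key {φ.ext 0} (I φ).toNNReal ⟨rfl, hc⟩
    -- In a pseudometric space the closure of a compact set only adds points at distance `0` from
    -- it, and distance `0` from a continuous path means equality.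
    rw [(hgood.isCompact_level {φ.ext 0} (by simpa using horth φ) isCompact_singleton _
      (by positivity)).closure_eq_biUnion_inseparable] at h1
    simp only [Set.mem_iUnion, Set.mem_ofPred_eq] at h1
    obtain ⟨ψ, ⟨-, hψ⟩, hins⟩ := h1
    have hac := hgood.absolutelyContinuous ψ (hψ.trans_lt ENNReal.coe_lt_top)
    have hcont : Continuous ψ.toFun := PathSpace.continuous_toFun_iff.2 (by
      have := hac.continuousOn
      rwa [Set.uIcc_of_le hT] at this)
    rw [PathSpace.ext_eq_of_toFun_eq (PathSpace.toFun_eq_of_edist_eq_zero hcont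
      (EMetric.inseparable_iff.1 hins))]
    exact hac

/-! ### Upper bounds for tubes -/

theorem exists_add_eq_of_lt_add {a b : ℝ≥0∞} {c : ℝ} (h : (c : EReal) < ((a + b : ℝ≥0∞) : EReal)) :
    ∃ c₁ c₂ : ℝ, (c₁ : EReal) < (a : EReal) ∧ (c₂ : EReal) < (b : EReal) ∧ c₁ + c₂ = c := by
  have hneg : ∀ x : ℝ≥0∞, ((-1 : ℝ) : EReal) < (x : EReal) := fun x =>
    lt_of_lt_of_le (by rw [← EReal.coe_zero, EReal.coe_lt_coe_iff]; norm_num)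
      (EReal.coe_ennreal_nonneg x)
  induction a with
  -- Costs are nonnegative, so `-1` lies strictly below any of them, and an infinite cost takes the
  -- rest.
  | top => exact ⟨c + 1, -1, by simpa using EReal.coe_lt_top (c + 1), hneg b, by ring⟩
  | coe a =>
    induction b with
    | top => exact ⟨-1, c + 1, hneg a, by simpa using EReal.coe_lt_top (c + 1), by ring⟩
    | coe b =>
      rw [← ENNReal.coe_add, EReal.coe_nnreal_eq_coe_real, EReal.coe_lt_coe_iff, NNReal.coe_add] at h
      refine ⟨a - (a + b - c) / 2, b - (a + b - c) / 2, ?_, ?_, by ring⟩ <;>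
      · rw [EReal.coe_nnreal_eq_coe_real, EReal.coe_lt_coe_iff]
        linarith

namespace MarkovProcess

variable {N : ℕ} {S : Set (RN N)} {Ω : Type*} [MeasurableSpace Ω]

/-- A tube around a path whose coordinates in `Λ` are bounded away from `0` excludes the boundary. -/
theorem lt_hittingTime_of_mem_closedTube (M : MarkovProcess S Ω) {Λ : Finset (Fin N)} {n : ℕ}
    {f : ℝ → RN N} {l m δ : ℝ} (hl : 0 ≤ l) (hδ : δ < m)
    (hm : ∀ t, 0 ≤ t → t ≤ l → ∀ i ∈ Λ, m ≤ f t i) {ω : Ω} (hω : ω ∈ M.closedTube n f 0 l δ) :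
    ENNReal.ofReal l < M.hittingTime Λ n ω := by
  have hpos : ∀ t, 0 ≤ t → t ≤ l → ∀ i ∈ Λ, 0 < M.Z n t.toNNReal ω i := by
    intro t h0 h1 i hi
    have h2 := hω t h0 h1
    rw [zero_add] at h2
    have h3 := (PiLp.norm_apply_le (M.Z n t.toNNReal ω - f t) i).trans h2
    rw [PiLp.sub_apply, Real.norm_eq_abs, abs_le] at h3
    linarith [hm t h0 h1 i hi, h3.1]
  -- Positivity on `[0,l]` alone would allow the infimum to equal `l`; right continuity at `l` makes
  -- the inequality strict.
  have hev : ∀ᶠ s in 𝓝[≥] l.toNNReal, ∀ i ∈ Λ, 0 < M.Z n s ω i := by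
    refine (Finset.eventually_all Λ).2 fun i hi => ?_
    have hc : ContinuousWithinAt (fun s => M.Z n s ω i) (Set.Ici l.toNNReal) l.toNNReal :=
      (EuclideanSpace.proj (𝕜 := ℝ) i).continuous.continuousAt.comp_continuousWithinAt
        (M.continuousWithinAt_Z n ω l.toNNReal)
    exact hc.eventually (lt_mem_nhds (hpos l hl le_rfl i hi))
  obtain ⟨u, hu, hsub⟩ := (mem_nhdsGE_iff_exists_Ico_subset' (lt_add_one l.toNNReal)).1 hev
  have hlu : ENNReal.ofReal l < (u : ℝ≥0∞) := ENNReal.coe_lt_coe.2 hu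
  refine hlu.trans_le (le_iInf₂ fun t ht => ?_)
  obtain ⟨i, hi, h0⟩ := ht
  rw [ENNReal.coe_le_coe]
  by_contra! hlt
  rcases le_total t l.toNNReal with h1 | h1
  · have := hpos t t.2 (by
      have : (t : ℝ) ≤ l.toNNReal := by exact_mod_cast h1
      rwa [Real.coe_toNNReal l hl] at this) i hi
    rw [Real.toNNReal_coe, h0] at this
    exact this.false
  · have := hsub ⟨h1, hlt⟩ i hi
    rw [h0] at this
    exact this.false

/-- A thin tube ends near `f l` and keeps the coordinates in `Λ` positive, so it is contained in the
event of (A3). The starting radius `2 * δ` exceeds the tube radius so that a preceding closed tube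
of radius `δ` leads into it. -/
theorem AssumptionA3.exists_tube {M : MarkovProcess S Ω} {L : Finset (Fin N) → RN N → ℝ≥0∞}
    (hA3 : M.AssumptionA3 L) {Λ : Finset (Fin N)} {f : ℝ → RN N} {l m : ℝ} (hl : 0 < l) (hm0 : 0 < m)
    (hm : ∀ t, 0 ≤ t → t ≤ l → ∀ i ∈ Λ, m ≤ f t i) (h0 : f 0 ∈ face Λ) (h1 : f l ∈ face Λ) {c : ℝ}
    (hc : (c : EReal) < ((ENNReal.ofReal l * L Λ (l⁻¹ • (f l - f 0)) : ℝ≥0∞) : EReal)) :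
    ∃ δ > 0, ∀ᶠ n : ℕ in atTop, ∀ z : scaledStates S n, ‖(z : RN N) - f 0‖ < 2 * δ →
      M.scaledLaw n z (M.closedTube n f 0 l δ) ≤ ENNReal.ofReal (Real.exp (-(n * c))) := by
  have h2 := (hA3 Λ l hl _ h0 _ h1).trans_lt (EReal.neg_lt_neg_iff.2 hc)
  obtain ⟨δ, hδ, hδ0⟩ := ((eventually_lt_of_limsup_lt h2).and self_mem_nhdsWithin).exists
  rw [← EReal.coe_neg] at hδ
  have hδ0 : 0 < δ := hδ0
  refine ⟨min (δ / 2) (m / 2), lt_min (half_pos hδ0) (half_pos hm0), ?_⟩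
  filter_upwards [M.eventually_le_of_upperRate_lt hδ] with n hn z hz
  refine le_trans (measure_mono ?_) (hn z (hz.trans_le ?_))
  · intro ω hω
    refine ⟨?_, M.lt_hittingTime_of_mem_closedTube hl.le ((min_le_right _ _).trans_lt
      (half_lt_self hm0)) hm hω⟩
    have := hω l hl.le le_rfl
    rw [zero_add] at this
    exact this.trans_lt ((min_le_left _ _).trans_lt (half_lt_self hδ0))
  · linarith [min_le_left (δ / 2) (m / 2)]

theorem closedTube_anti (M : MarkovProcess S Ω) (n : ℕ) (f : ℝ → RN N) (a : ℝ≥0) {l l' c c' : ℝ}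
    (hl : l ≤ l') (hc : c' ≤ c) : M.closedTube n f a l' c' ⊆ M.closedTube n f a l c :=
  fun _ hω t h0 h1 => (hω t h0 (h1.trans hl)).trans hc

/-- The probability that `Z_n` follows `g` up to time `e` decays at least at rate `A`. -/
def TubeUpper (M : MarkovProcess S Ω) (g : ℝ → RN N) (e : ℝ) (A : ℝ≥0∞) : Prop :=
  ∀ c : ℝ, (c : EReal) < (A : EReal) → ∃ δ > 0, ∀ᶠ n : ℕ in atTop, ∀ z : scaledStates S n,
    M.scaledLaw n z (M.closedTube n g 0 e δ) ≤ ENNReal.ofReal (Real.exp (-(n * c)))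

theorem scaledLaw_le_of_nonpos (M : MarkovProcess S Ω) {n : ℕ} (z : scaledStates S n) (A : Set Ω)
    {c : ℝ} (hc : c ≤ 0) : M.scaledLaw n z A ≤ ENNReal.ofReal (Real.exp (-(n * c))) := by
  have hP := M.isProbabilityMeasure_scaledLaw n z
  refine prob_le_one.trans ?_
  rw [ENNReal.one_le_ofReal, Real.one_le_exp_iff]
  nlinarith [(Nat.cast_nonneg n : (0 : ℝ) ≤ n)]

theorem tubeUpper_zero (M : MarkovProcess S Ω) (g : ℝ → RN N) (e : ℝ) : M.TubeUpper g e 0 := by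
  intro c hc
  refine ⟨1, one_pos, Eventually.of_forall fun n z => M.scaledLaw_le_of_nonpos z _ ?_⟩
  rw [EReal.coe_ennreal_zero] at hc
  exact_mod_cast hc.le

/-- This is how gaps are crossed: the tube is prolonged without any gain in the rate. -/
theorem TubeUpper.mono {M : MarkovProcess S Ω} {g : ℝ → RN N} {e e' : ℝ} {A : ℝ≥0∞}
    (h : M.TubeUpper g e A) (he : e ≤ e') : M.TubeUpper g e' A := by
  intro c hc
  obtain ⟨δ, hδ, H⟩ := h c hc
  exact ⟨δ, hδ, H.mono fun n hn z => (measure_mono (M.closedTube_anti n g 0 he le_rfl)).trans (hn z)⟩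

/-- The tube up to time `s` puts `Z_n(s)` near `g s`, from where (A3) controls the next piece, at
the cost of the straight segment between its endpoints. -/
theorem TubeUpper.step {M : MarkovProcess S Ω} {L : Finset (Fin N) → RN N → ℝ≥0∞}
    (hA3 : M.AssumptionA3 L) {g : ℝ → RN N} (hg : Continuous g) {s l m : ℝ} {A : ℝ≥0∞}
    (h : M.TubeUpper g s A) (hs : 0 ≤ s) (hl : 0 < l) {Λ : Finset (Fin N)} (hm0 : 0 < m)
    (hm : ∀ t, s ≤ t → t ≤ s + l → ∀ i ∈ Λ, m ≤ g t i) (h0 : g s ∈ face Λ)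
    (h1 : g (s + l) ∈ face Λ) :
    M.TubeUpper g (s + l) (A + ENNReal.ofReal l * L Λ (l⁻¹ • (g (s + l) - g s))) := by
  intro c hc
  obtain ⟨c₁, c₂, hc₁, hc₂, rfl⟩ := exists_add_eq_of_lt_add hc
  obtain ⟨δ₁, hδ₁, H₁⟩ := h c₁ hc₁
  obtain ⟨δ₂, hδ₂, H₂⟩ := hA3.exists_tube (f := fun t => g (s + t)) hl hm0
    (fun t ht0 ht => hm _ (by linarith) (by linarith)) (by simpa using h0) h1 (by simpa using hc₂)
  refine ⟨min δ₁ δ₂, lt_min hδ₁ hδ₂, ?_⟩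
  filter_upwards [H₁, H₂, eventually_ge_atTop 1] with n H₁ H₂ hn z
  have key := M.scaledLaw_inter_le_mul hn z (f := fun t => g (s + t)) (by fun_prop) s.toNNReal hl.le
    δ₂ (M.measurableSet_closedTube n hg hs (min δ₁ δ₂)) (p := g (s + 0)) (ε := 2 * δ₂)
    (fun ω hω => by
      have := hω s hs le_rfl
      rw [zero_add] at this
      rw [add_zero]
      linarith [min_le_right δ₁ δ₂]) H₂
  have hsub : M.closedTube n g 0 (s + l) (min δ₁ δ₂) ⊆ M.closedTube n g 0 s (min δ₁ δ₂) ∩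
      M.closedTube n (fun t => g (s + t)) s.toNNReal l δ₂ := by
    refine fun ω hω => ⟨M.closedTube_anti n g 0 (by linarith) le_rfl hω, fun t ht0 ht => ?_⟩
    have := hω (s + t) (by linarith) (by linarith)
    rw [zero_add, Real.toNNReal_add hs ht0] at this
    exact this.trans (min_le_right _ _)
  calc M.scaledLaw n z (M.closedTube n g 0 (s + l) (min δ₁ δ₂))
      ≤ _ := measure_mono hsub
    _ ≤ _ := key
    _ ≤ ENNReal.ofReal (Real.exp (-(n * c₂))) * ENNReal.ofReal (Real.exp (-(n * c₁))) := by
        gcongr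
        exact (measure_mono (M.closedTube_anti n g 0 le_rfl (min_le_left _ _))).trans (H₁ z)
    _ = _ := by
        rw [← ENNReal.ofReal_mul (Real.exp_pos _).le, ← Real.exp_add]; congr 2; ring

end MarkovProcess

/-! ### Decomposition of an absolutely continuous path -/

/-- On a grid of mesh at most `h`, `e j` is the last point of `K` up to the `j`-th grid point and `s
j` the first one from there on. Nothing of `K` lies strictly between them. -/
theorem exists_skeleton_of_isCompact {K : Set ℝ} (hK : IsCompact K) {T : ℝ}
    (hKT : K ⊆ Set.Icc 0 T) (h0 : 0 ∈ K) (hT : T ∈ K) {h : ℝ} (hh : 0 < h) :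
    ∃ (m : ℕ) (e s : ℕ → ℝ), Monotone e ∧ e 0 = 0 ∧ e m = T ∧
      (∀ j, e j ∈ K) ∧ ∀ j < m, s j ∈ K ∧ e j ≤ s j ∧ s j ≤ e (j + 1) ∧ e (j + 1) - s j ≤ h ∧
        ∀ t ∈ K, t ≤ e j ∨ s j ≤ t := by
  have hT0 : 0 ≤ T := (hKT hT).1
  obtain ⟨m, hm⟩ := exists_nat_gt (T / h)
  have hm0 : (0 : ℝ) < m := (div_nonneg hT0 hh.le).trans_lt hm
  have hTm : T / m ≤ h := by
    rw [div_lt_iff₀ hh] at hm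
    rw [div_le_iff₀ hm0]
    linarith
  let b : ℕ → ℝ := fun j => j * (T / m)
  have hb : ∀ j, 0 ≤ b j := fun j => by positivity
  have hbm : Monotone b := fun i j hij => by
    have : (i : ℝ) ≤ j := by exact_mod_cast hij
    dsimp only [b]
    gcongr
  have hbT : b m = T := mul_div_cancel₀ _ hm0.ne'
  have hne : ∀ j, (K ∩ Set.Iic (b j)).Nonempty := fun j => ⟨0, h0, hb j⟩
  have hcp : ∀ j, IsCompact (K ∩ Set.Iic (b j)) := fun j => hK.inter_right isClosed_Iic
  have hmem : ∀ j, sSup (K ∩ Set.Iic (b j)) ∈ K ∩ Set.Iic (b j) := fun j => (hcp j).sSup_mem (hne j)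
  have hle : ∀ j, ∀ t ∈ K, t ≤ b j → t ≤ sSup (K ∩ Set.Iic (b j)) := fun j t h1 h2 =>
    le_csSup (hcp j).bddAbove ⟨h1, h2⟩
  have hmono : Monotone fun j => sSup (K ∩ Set.Iic (b j)) := fun i j hij =>
    hle j _ (hmem i).1 ((hmem i).2.trans (hbm hij))
  refine ⟨m, fun j => sSup (K ∩ Set.Iic (b j)),
    -- If `K` misses the cell, the minimum makes the piece from `s j` to `e (j + 1)` degenerate.
    fun j => min (sSup (K ∩ Set.Iic (b (j + 1)))) (sInf (K ∩ Set.Ici (b j))), hmono, ?_, ?_,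
    fun j => (hmem j).1, fun j hj => ?_⟩
  · refine le_antisymm ((hmem 0).2.trans ?_) (hle 0 0 h0 (hb 0))
    simp [b]
  · exact le_antisymm ((hmem m).2.trans hbT.le) (hle m T hT hbT.ge)
  · have hcp' : IsCompact (K ∩ Set.Ici (b j)) := hK.inter_right isClosed_Ici
    have hmem' := hcp'.sInf_mem ⟨T, hT, hbT ▸ hbm hj.le⟩
    refine ⟨?_, le_min (hmono j.le_succ) ((hmem j).2.trans hmem'.2), min_le_left _ _, ?_,
      fun t ht => ?_⟩
    · rcases min_choice (sSup (K ∩ Set.Iic (b (j + 1)))) (sInf (K ∩ Set.Ici (b j))) with h | h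
      · simp only [h]; exact (hmem _).1
      · simp only [h]; exact hmem'.1
    · rcases le_total (sSup (K ∩ Set.Iic (b (j + 1)))) (sInf (K ∩ Set.Ici (b j))) with h1 | h1
      · simp only [min_eq_left h1, sub_self]; exact hh.le
      · simp only [min_eq_right h1]
        have h2 : sSup (K ∩ Set.Iic (b (j + 1))) ≤ b (j + 1) := (hmem (j + 1)).2
        have h3 : b j ≤ sInf (K ∩ Set.Ici (b j)) := hmem'.2
        have h4 : b (j + 1) = b j + T / m := by simp only [b]; push_cast; ring
        linarith
    · rcases le_total t (b j) with h1 | h1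
      · exact Or.inl (hle j t ht h1)
      · exact Or.inr ((min_le_right _ _).trans (csInf_le hcp'.bddBelow ⟨ht, h1⟩))

/-- The pieces from `s j` to `e (j + 1)`, together with the point `0`, cover `K`; the gaps therefore
have total length at most `T - |K|`. -/
theorem volume_le_sum_of_skeleton {K : Set ℝ} {T : ℝ} (hKT : K ⊆ Set.Icc 0 T) {m : ℕ} {e s : ℕ → ℝ}
    (h0 : e 0 = 0) (hm : e m = T)
    (hes : ∀ j < m, s j ≤ e (j + 1) ∧ ∀ t ∈ K, t ≤ e j ∨ s j ≤ t) :
    volume K ≤ ENNReal.ofReal (∑ j ∈ Finset.range m, (e (j + 1) - s j)) := by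
  have key : ∀ k ≤ m, volume (K ∩ Set.Iic (e k)) ≤
      ENNReal.ofReal (∑ j ∈ Finset.range k, (e (j + 1) - s j)) := by
    intro k
    induction k with
    | zero =>
      intro _
      refine le_trans (measure_mono (t := {0}) ?_) (by simp)
      rintro t ⟨ht, ht'⟩
      rw [Set.mem_Iic, h0] at ht'
      exact le_antisymm ht' (hKT ht).1
    | succ k ih =>
      intro hk
      have h1 := hes k hk
      rw [Finset.sum_range_succ, ENNReal.ofReal_add (Finset.sum_nonneg fun j hj =>
        sub_nonneg.2 (hes j (by rw [Finset.mem_range] at hj; omega)).1) (sub_nonneg.2 h1.1)]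
      refine le_trans (measure_mono (t := (K ∩ Set.Iic (e k)) ∪ Set.Icc (s k) (e (k + 1))) ?_)
        ((measure_union_le _ _).trans (add_le_add (ih (by omega)) (by rw [Real.volume_Icc])))
      rintro t ⟨ht, ht'⟩
      rcases h1.2 t ht with h2 | h2
      · exact Or.inl ⟨ht, h2⟩
      · exact Or.inr ⟨h2, ht'⟩
  refine le_trans (measure_mono ?_) (key m le_rfl)
  exact fun t ht => ⟨ht, hm ▸ (hKT ht).2⟩

/-- Times at which each coordinate of `g` is `0` or at least `1 / (k + 1)`. -/
def gapTimes {N : ℕ} (g : ℝ → RN N) (T : ℝ) (k : ℕ) : Set ℝ :=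
  Set.Icc 0 T ∩ ⋂ i, {t | g t i = 0 ∨ 1 / ((k : ℝ) + 1) ≤ g t i}

theorem mem_gapTimes {N : ℕ} {g : ℝ → RN N} {T : ℝ} {k : ℕ} {t : ℝ} :
    t ∈ gapTimes g T k ↔ t ∈ Set.Icc 0 T ∧ ∀ i, g t i = 0 ∨ 1 / ((k : ℝ) + 1) ≤ g t i := by
  simp [gapTimes]

theorem isCompact_gapTimes {N : ℕ} {g : ℝ → RN N} (hg : Continuous g) (T : ℝ) (k : ℕ) :
    IsCompact (gapTimes g T k) := by
  refine isCompact_Icc.inter_right (isClosed_iInter fun i => ?_)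
  have hi : Continuous fun t => g t i := (EuclideanSpace.proj (𝕜 := ℝ) i).continuous.comp hg
  exact (isClosed_eq hi continuous_const).union (isClosed_le continuous_const hi)

theorem monotone_gapTimes {N : ℕ} (g : ℝ → RN N) (T : ℝ) : Monotone (gapTimes g T) := by
  intro k l hkl t ht
  rw [mem_gapTimes] at ht ⊢
  exact ⟨ht.1, fun i => (ht.2 i).imp_right (Nat.one_div_le_one_div hkl).trans⟩

theorem eventually_mem_gapTimes {N : ℕ} {g : ℝ → RN N} {T : ℝ} {t : ℝ} (ht : t ∈ Set.Icc 0 T)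
    (ho : g t ∈ orthant N) : ∀ᶠ k in atTop, t ∈ gapTimes g T k := by
  have : ∀ i, ∀ᶠ k : ℕ in atTop, g t i = 0 ∨ 1 / ((k : ℝ) + 1) ≤ g t i := by
    intro i
    rcases (ho i).eq_or_lt with h | h
    · exact Eventually.of_forall fun k => Or.inl h.symm
    · exact ((tendsto_one_div_add_atTop_nhds_zero_nat (𝕜 := ℝ)).eventually (gt_mem_nhds h)).mono
        fun k hk => Or.inr hk.le
  filter_upwards [eventually_all.2 this] with k hk
  exact mem_gapTimes.2 ⟨ht, hk⟩

/-- Up to gaps of small total length and small total variation, an absolutely continuous path in the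
orthant decomposes into short pieces that start and end in a common face `B_Λ`, and on which the
coordinates in `Λ` stay away from `0`. -/
theorem exists_skeleton {N : ℕ} {g : ℝ → RN N} (hg : UniformContinuous g) {T : ℝ} (hT : 0 ≤ T)
    (ho : ∀ t ∈ Set.Icc 0 T, g t ∈ orthant N) (hac : AbsolutelyContinuousOnInterval g 0 T) {η : ℝ}
    (hη : 0 < η) :
    ∃ (m : ℕ) (e s : ℕ → ℝ), Monotone e ∧ e 0 = 0 ∧ e m = T ∧
      ∑ j ∈ Finset.range m, (s j - e j) ≤ η ∧ ∑ j ∈ Finset.range m, ‖g (s j) - g (e j)‖ ≤ η ∧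
      ∀ j < m, e j ≤ s j ∧ s j ≤ e (j + 1) ∧ e (j + 1) - s j ≤ η ∧ ∃ Λ, ∃ γ > 0,
        g (s j) ∈ face Λ ∧ g (e (j + 1)) ∈ face Λ ∧
          ∀ t, s j ≤ t → t ≤ e (j + 1) → ∀ i ∈ Λ, γ ≤ g t i := by
  obtain ⟨δ, hδ, hacδ⟩ := (absolutelyContinuousOnInterval_iff g 0 T).1 hac η hη
  have hδη : 0 < min δ η / 2 := half_pos (lt_min hδ hη)
  have hU : ⋃ k, gapTimes g T k = Set.Icc 0 T := by
    refine Set.Subset.antisymm (Set.iUnion_subset fun k t ht => (mem_gapTimes.1 ht).1) fun t ht => ?_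
    obtain ⟨k, hk⟩ := (eventually_mem_gapTimes ht (ho t ht)).exists
    exact Set.mem_iUnion.2 ⟨k, hk⟩
  -- The sets of gap times increase to `[0,T]`, so one of them has nearly full measure.
  have hvol := tendsto_measure_iUnion_atTop (μ := volume) (monotone_gapTimes g T)
  rw [hU, Real.volume_Icc, sub_zero] at hvol
  have hvol' : ∀ᶠ k in atTop, ENNReal.ofReal (T - min δ η / 2) ≤ volume (gapTimes g T k) := by
    rcases hT.eq_or_lt with rfl | hT
    · rw [ENNReal.ofReal_of_nonpos (by linarith)]; simp
    · exact (hvol.eventually (lt_mem_nhds ((ENNReal.ofReal_lt_ofReal_iff hT).2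
        (by linarith)))).mono fun k hk => hk.le
  have h0T : (0 : ℝ) ∈ Set.Icc 0 T := ⟨le_rfl, hT⟩
  have hTT : T ∈ Set.Icc 0 T := ⟨hT, le_rfl⟩
  obtain ⟨k, hk, hk0, hkT⟩ := (hvol'.and ((eventually_mem_gapTimes h0T (ho _ h0T)).and
    (eventually_mem_gapTimes hTT (ho _ hTT)))).exists
  set κ : ℝ := 1 / ((k : ℝ) + 1) with hκ
  have hκ0 : 0 < κ := by positivity
  -- On a short piece no coordinate moves by `κ / 2`. At its ends each coordinate is `0` or at least
  -- `κ`, so both ends have the same positive coordinates, and these stay above `κ / 2` in between.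
  obtain ⟨h, hh, hmod⟩ := Metric.uniformContinuous_iff.1 hg (κ / 2) (half_pos hκ0)
  have hcoord : ∀ s t, |s - t| ≤ h / 2 → ∀ i, |g s i - g t i| < κ / 2 := by
    intro s t hst i
    have h1 := hmod (a := s) (b := t) (by rw [Real.dist_eq]; linarith)
    rw [dist_eq_norm] at h1
    exact (PiLp.norm_apply_le (g s - g t) i).trans_lt h1
  have hsub : gapTimes g T k ⊆ Set.Icc 0 T := fun t ht => (mem_gapTimes.1 ht).1
  obtain ⟨m, e, s, hmono, he0, hem, heK, hes⟩ := exists_skeleton_of_isCompact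
    (isCompact_gapTimes hg.continuous T k) hsub hk0 hkT (lt_min (half_pos hh) hη)
  have hsum : ∑ j ∈ Finset.range m, (s j - e j) ≤ min δ η / 2 := by
    have h1 := hk.trans (volume_le_sum_of_skeleton hsub he0 hem fun j hj =>
      ⟨(hes j hj).2.2.1, (hes j hj).2.2.2.2⟩)
    rw [ENNReal.ofReal_le_ofReal_iff (Finset.sum_nonneg fun j hj =>
      sub_nonneg.2 (hes j (Finset.mem_range.1 hj)).2.2.1)] at h1
    have h2 : ∑ j ∈ Finset.range m, (s j - e j) + ∑ j ∈ Finset.range m, (e (j + 1) - s j) = T := by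
      rw [← Finset.sum_add_distrib, Finset.sum_congr rfl fun j _ => sub_add_sub_cancel' _ _ _,
        Finset.sum_range_sub, he0, hem, sub_zero]
    linarith
  refine ⟨m, e, s, hmono, he0, hem, ?_, ?_, fun j hj => ?_⟩
  · linarith [min_le_right δ η, hδη]
  -- The gaps are disjoint intervals of total length below `δ`, so absolute continuity bounds the
  -- variation across them.
  · have h1 := hacδ (m, fun j => (e j, s j)) ⟨fun j hj => ?_, ?_⟩ ?_
    · simp only [dist_eq_norm] at h1
      exact (le_of_eq (Finset.sum_congr rfl fun j _ => norm_sub_rev _ _)).trans h1.le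
    · rw [Set.uIcc_of_le hT]
      exact ⟨hsub (heK j), hsub (hes j (Finset.mem_range.1 hj)).1⟩
    · have hdis : ∀ i < m, ∀ j < m, i < j → Disjoint (Set.uIoc (e i) (s i)) (Set.uIoc (e j) (s j)) := by
        intro i hi j hj hij
        rw [Set.uIoc_of_le (hes i hi).2.1, Set.uIoc_of_le (hes j hj).2.1]
        refine Set.disjoint_left.2 fun t h1 h2 => ?_
        have h3 := (hes i hi).2.2.1
        have h4 := hmono (Nat.succ_le_of_lt hij)
        linarith [h1.2, h2.1]
      intro i hi j hj hij
      have hi' : i < m := by simpa using hi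
      have hj' : j < m := by simpa using hj
      rcases lt_or_gt_of_ne hij with h | h
      · exact hdis i hi' j hj' h
      · exact (hdis j hj' i hi' h).symm
    · have : ∑ j ∈ Finset.range m, dist (e j) (s j) = ∑ j ∈ Finset.range m, (s j - e j) :=
        Finset.sum_congr rfl fun j hj => by
          rw [dist_comm, Real.dist_eq,
            abs_of_nonneg (sub_nonneg.2 (hes j (Finset.mem_range.1 hj)).2.1)]
      simp only [this]
      linarith [min_le_left δ η]
  · obtain ⟨hsK, h1, h2, h3, -⟩ := hes j hj
    have h4 : e (j + 1) - s j ≤ h / 2 := h3.trans (min_le_left _ _)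
    have hs := mem_gapTimes.1 hsK
    have he := mem_gapTimes.1 (heK (j + 1))
    refine ⟨h1, h2, h3.trans (min_le_right _ _), posSet (g (s j)), κ / 2, half_pos hκ0,
      ⟨ho _ hs.1, rfl⟩, ⟨ho _ he.1, ?_⟩, fun t ht1 ht2 i hi => ?_⟩
    · ext i
      have h5 := abs_lt.1 (hcoord (s j) (e (j + 1)) (by
        rw [abs_sub_comm, abs_le]; constructor <;> linarith) i)
      simp only [posSet, Finset.mem_filter, Finset.mem_univ, true_and]
      rcases hs.2 i with h6 | h6 <;> rcases he.2 i with h7 | h7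
      · rw [h6, h7]
      · rw [h6] at h5; linarith [h5.1]
      · rw [h7] at h5; linarith [h5.2]
      · exact iff_of_true (hκ0.trans_le h7) (hκ0.trans_le h6)
    · have h5 := abs_lt.1 (hcoord (s j) t (by rw [abs_sub_comm, abs_le]; constructor <;> linarith) i)
      have h6 : 0 < g (s j) i := by
        simpa only [posSet, Finset.mem_filter, Finset.mem_univ, true_and] using hi
      rcases hs.2 i with h7 | h7
      · rw [h7] at h6; exact absurd h6 (lt_irrefl 0)
      · linarith [h5.2]

theorem mem_face_iff {N : ℕ} {Λ : Finset (Fin N)} {x : RN N} :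
    x ∈ face Λ ↔ (∀ i ∈ Λ, 0 < x i) ∧ ∀ i ∉ Λ, x i = 0 := by
  constructor
  · rintro ⟨ho, rfl⟩
    simp only [posSet, Finset.mem_filter, Finset.mem_univ, true_and]
    exact ⟨fun i hi => hi, fun i hi => le_antisymm (not_lt.1 hi) (ho i)⟩
  · rintro ⟨h1, h2⟩
    refine ⟨fun i => ?_, ?_⟩
    · by_cases hi : i ∈ Λ
      · exact (h1 i hi).le
      · exact (h2 i hi).ge
    · ext i
      simp only [posSet, Finset.mem_filter, Finset.mem_univ, true_and]
      refine ⟨fun h => ?_, h1 i⟩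
      by_contra hi
      exact h.ne' (h2 i hi)

theorem segment_mem_face {N : ℕ} {Λ : Finset (Fin N)} {a b : RN N} (ha : a ∈ face Λ)
    (hb : b ∈ face Λ) {l t : ℝ} (hl : 0 < l) (ht : t ∈ Set.Icc 0 l) :
    a + t • (l⁻¹ • (b - a)) ∈ face Λ := by
  have ec : ∀ i : Fin N, (a + t • (l⁻¹ • (b - a))) i = (1 - t / l) * a i + t / l * b i := by
    intro i
    simp only [PiLp.add_apply, PiLp.smul_apply, PiLp.sub_apply, smul_eq_mul]
    ring
  have h1 : 0 ≤ t / l := div_nonneg ht.1 hl.le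
  have h2 : t / l ≤ 1 := (div_le_one hl).2 ht.2
  rw [mem_face_iff] at *
  refine ⟨fun i hi => ?_, fun i hi => ?_⟩ <;> rw [ec]
  · nlinarith [ha.1 i hi, hb.1 i hi, mul_nonneg h1 (hb.1 i hi).le,
      mul_nonneg (sub_nonneg.2 h2) (ha.1 i hi).le, lt_min (ha.1 i hi) (hb.1 i hi),
      mul_le_mul_of_nonneg_left (min_le_right (a i) (b i)) h1,
      mul_le_mul_of_nonneg_left (min_le_left (a i) (b i)) (sub_nonneg.2 h2)]
  · rw [ha.2 i hi, hb.2 i hi]; ring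

theorem Reach.straight {N : ℕ} {L : Finset (Fin N) → RN N → ℝ≥0∞} {g : ℝ → RN N} {ρ : ℝ} {x : RN N}
    {τ : ℝ} {p : RN N} {c : ℝ≥0∞} (h : Reach L g ρ x τ p c) {Λ : Finset (Fin N)} {q : RN N}
    (hp : p ∈ face Λ) (hq : q ∈ face Λ) {l : ℝ} (hl : 0 < l)
    (hg : ∀ t ∈ Set.Icc 0 l, ‖p - g (τ + t)‖ + ‖q - p‖ ≤ ρ) :
    Reach L g ρ x (τ + l) q (c + ENNReal.ofReal l * L Λ (l⁻¹ • (q - p))) := by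
  have H := h.step (v := l⁻¹ • (q - p)) hl (fun t ht => (segment_mem_face hp hq hl ht).1)
    (fun t ht => segment_mem_face hp hq hl ⟨ht.1.le, ht.2.le⟩) fun t ht => ?_
  · rwa [smul_inv_smul₀ hl.ne', add_sub_cancel] at H
  · have h1 : ‖t • (l⁻¹ • (q - p))‖ ≤ ‖q - p‖ := by
      rw [norm_smul, norm_smul, norm_inv, Real.norm_of_nonneg hl.le, Real.norm_of_nonneg ht.1,
        ← mul_assoc]
      have : t * l⁻¹ ≤ 1 := (div_le_one hl).2 ht.2
      exact mul_le_of_le_one_left (norm_nonneg _) this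
    calc ‖p + t • (l⁻¹ • (q - p)) - g (τ + t)‖ = ‖(p - g (τ + t)) + t • (l⁻¹ • (q - p))‖ := by
          congr 1; abel
      _ ≤ _ := norm_add_le _ _
      _ ≤ ρ := by linarith [hg t ht]

/-! ### The local and the global upper bound -/

namespace MarkovProcess

variable {N : ℕ} {S : Set (RN N)} {Ω : Type*} [MeasurableSpace Ω] {T : ℝ}

/-- An absolutely continuous path can be approximated by chains whose cost exceeds the decay rate of
tubes around the path by as little as wanted. -/
theorem exists_reach_tubeUpper {M : MarkovProcess S Ω} {L : Finset (Fin N) → RN N → ℝ≥0∞}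
    (hA3 : M.AssumptionA3 L) {r : ℝ} (hr : 0 < r) {C : ℝ≥0}
    (hC : ∀ v, ‖v‖ ≤ r → L Finset.univ v ≤ C) {g : ℝ → RN N} (hg : UniformContinuous g)
    (hT : 0 ≤ T) (ho : ∀ t ∈ Set.Icc 0 T, g t ∈ orthant N)
    (hac : AbsolutelyContinuousOnInterval g 0 T) {ρ : ℝ} (hρ : 0 < ρ) {ζ : ℝ≥0∞} (hζ : 0 < ζ) :
    ∃ A τ p, ∃ c ≤ A + ζ, T ≤ τ ∧ Reach L g ρ (g 0) τ p c ∧ M.TubeUpper g T A := by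
  obtain ⟨κ, hκ, hmod⟩ := Metric.uniformContinuous_iff.1 hg (ρ / 4) (by positivity)
  have hmod' : ∀ s t, |s - t| < κ → ‖g s - g t‖ ≤ ρ / 4 := fun s t h => by
    rw [← dist_eq_norm]
    exact (hmod (by rwa [Real.dist_eq])).le
  -- Accumulated delays are at most `2 * η / r` and a single detour lasts at most `η + 2 * η / r`;
  -- their sum is the largest time shift. The second bound limits how far a detour strays, the third
  -- the cost of all detours.
  obtain ⟨η, hη, hηκ, hηρ, hηζ⟩ : ∃ η > 0, η + 4 * η / r < κ ∧ r * η + 2 * η < ρ / 2 ∧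
      ENNReal.ofReal (η + 2 * η / r) * C < ζ := by
    have l1 : Tendsto (fun η : ℝ => η + 4 * η / r) (𝓝[>] 0) (𝓝 (0 + 4 * 0 / r)) :=
      (Continuous.tendsto (by fun_prop) 0).mono_left nhdsWithin_le_nhds
    have l2 : Tendsto (fun η : ℝ => r * η + 2 * η) (𝓝[>] 0) (𝓝 (r * 0 + 2 * 0)) :=
      (Continuous.tendsto (by fun_prop) 0).mono_left nhdsWithin_le_nhds
    have l3 : Tendsto (fun η : ℝ => ENNReal.ofReal (η + 2 * η / r) * C) (𝓝[>] 0)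
        (𝓝 (ENNReal.ofReal (0 + 2 * 0 / r) * C)) := by
      refine ENNReal.Tendsto.mul_const ?_ (Or.inr ENNReal.coe_ne_top)
      refine (Continuous.tendsto ?_ 0).mono_left nhdsWithin_le_nhds
      exact ENNReal.continuous_ofReal.comp (by fun_prop)
    obtain ⟨η, ⟨h1, h2, h3⟩, h4⟩ := (((l1.eventually (gt_mem_nhds (by simpa using hκ))).and
      ((l2.eventually (gt_mem_nhds (show r * 0 + 2 * 0 < ρ / 2 by simpa using hρ))).and
        (l3.eventually (gt_mem_nhds (by simpa using hζ))))).and self_mem_nhdsWithin).exists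
    exact ⟨η, h4, h1, h2, h3⟩
  obtain ⟨m, e, s, hmono, he0, hem, hsum, hvar, hes⟩ := exists_skeleton hg hT ho hac hη
  -- Extra time that makes every detour of positive length and strictly slower than `r`; the `m` of
  -- them together contribute at most `η / r`.
  set θ : ℝ := η / (m + 1) with hθ
  have hθ0 : 0 < θ := by positivity
  have hmθ : m * θ ≤ η := by
    have : (m + 1) * θ = η := mul_div_cancel₀ _ (by positivity)
    linarith
  -- the delays caused by the detours
  let D : ℕ → ℝ := fun k => ∑ j ∈ Finset.range k, (‖g (s j) - g (e j)‖ + θ) / r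
  let W : ℕ → ℝ := fun k => ∑ j ∈ Finset.range k, (s j - e j)
  have hD : ∀ k, D (k + 1) = D k + (‖g (s k) - g (e k)‖ + θ) / r := fun k =>
    Finset.sum_range_succ _ _
  have hW : ∀ k, W (k + 1) = W k + (s k - e k) := fun k => Finset.sum_range_succ _ _
  have hD0 : ∀ k, 0 ≤ D k := fun k => Finset.sum_nonneg fun j _ => by positivity
  have hDm : ∀ k ≤ m, D k ≤ 2 * η / r := by
    intro k hk
    calc D k ≤ D m := Finset.sum_le_sum_of_subset_of_nonneg (Finset.range_mono hk)
          fun j _ _ => by positivity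
      _ = (∑ j ∈ Finset.range m, ‖g (s j) - g (e j)‖ + m * θ) / r := by
          simp only [D]
          rw [← Finset.sum_div, Finset.sum_add_distrib]
          simp
      _ ≤ _ := by gcongr; linarith
  have hWm : ∀ k ≤ m, W k ≤ η := fun k hk =>
    (Finset.sum_le_sum_of_subset_of_nonneg (Finset.range_mono hk) fun j hj _ =>
      sub_nonneg.2 (hes j (Finset.mem_range.1 hj)).1).trans hsum
  have hW0 : ∀ k ≤ m, 0 ≤ W k := fun k hk => Finset.sum_nonneg fun j hj =>
      sub_nonneg.2 (hes j ((Finset.mem_range.1 hj).trans_le hk)).1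
  have heT : ∀ k ≤ m, e k ∈ Set.Icc 0 T := fun k hk => ⟨he0 ▸ hmono (Nat.zero_le k), hem ▸ hmono hk⟩
  -- The chain is at `g (e k)` with delay `D k`. Each piece adds the same amount to its cost and to
  -- the rate `A`, so the excess comes from the detours alone.
  have key : ∀ k ≤ m, ∃ A, ∃ c ≤ A + ENNReal.ofReal (W k + D k) * C,
      Reach L g ρ (g 0) (e k + D k) (g (e k)) c ∧ M.TubeUpper g (e k) A := by
    intro k
    induction k with
    | zero =>
      intro _
      refine ⟨0, 0, bot_le, ?_, ?_⟩
      · have : e 0 + D 0 = 0 := by simp [D, he0]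
        rw [this, he0]
        exact .start (ho 0 ⟨le_rfl, hT⟩) (by simp [hρ.le])
      · exact M.tubeUpper_zero g _
    | succ k ih =>
      intro hk
      obtain ⟨A, c, hc, hR, hA⟩ := ih (by omega)
      obtain ⟨h1, h2, h3, Λ, γ, hγ, hsΛ, heΛ, hpos⟩ := hes k hk
      have hek := heT k (by omega)
      have hek1 := heT (k + 1) hk
      have hDk := hD0 k
      have hDk1 := hDm (k + 1) hk
      have hWk1 := hWm (k + 1) hk
      have hWk := hW0 k (by omega)
      have hd : 0 < (‖g (s k) - g (e k)‖ + θ) / r := by positivity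
      rw [hD] at hDk1
      rw [hW] at hWk1
      have h4 : 4 * η / r = 2 * (2 * η / r) := by ring
      -- The detour takes the duration of the gap plus the time to cover the displacement at speed
      -- `r`; only the second part adds to the delay.
      set w := (s k - e k) + (‖g (s k) - g (e k)‖ + θ) / r with hw
      have hw0 : 0 < w := by linarith
      have hrw : r * w = r * (s k - e k) + (‖g (s k) - g (e k)‖ + θ) := by
        rw [hw, mul_add, mul_div_cancel₀ _ hr.ne']
      have hrw' : r * w ≤ r * η + 2 * η := by
        have h5 : w ≤ η + 2 * η / r := by linarith
        calc r * w ≤ r * (η + 2 * η / r) := by gcongr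
          _ = _ := by rw [mul_add, mul_div_cancel₀ _ hr.ne']
      obtain ⟨c₁, hc₁, hR₁⟩ := hR.detour hC (ho (s k) ⟨hek.1.trans h1, h2.trans hek1.2⟩) hw0
        (by rw [hrw]; nlinarith) fun t ht => by
          have := hmod' (e k) (e k + D k + t) (by
            rw [abs_sub_comm, abs_of_nonneg] <;> linarith [ht.1, ht.2])
          linarith
      have hτ : e k + D k + w = s k + D (k + 1) := by rw [hD, hw]; ring
      rw [hτ] at hR₁
      have hcost : c₁ ≤ A + ENNReal.ofReal (W (k + 1) + D (k + 1)) * C := by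
        have : W (k + 1) + D (k + 1) = (W k + D k) + w := by rw [hD, hW, hw]; ring
        rw [this, ENNReal.ofReal_add (by linarith) hw0.le, add_mul, ← add_assoc]
        exact hc₁.trans (add_le_add_left hc _)
      rcases h2.eq_or_lt with h2 | h2
      · rw [← h2]
        exact ⟨A, c₁, hcost, hR₁, hA.mono h1⟩
      · have hl : 0 < e (k + 1) - s k := sub_pos.2 h2
        have hR₂ := hR₁.straight hsΛ heΛ hl fun t ht => by
          have h5 := hmod' (s k) (s k + D (k + 1) + t) (by
            rw [hD, abs_sub_comm, abs_of_nonneg] <;> linarith [ht.1, ht.2])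
          have h6 := hmod' (e (k + 1)) (s k) (by rw [abs_of_pos hl]; linarith)
          linarith
        have hA₂ := (hA.mono h1).step hA3 hg.continuous (hek.1.trans h1) hl hγ
          (fun t ht1 ht2 => hpos t ht1 (by linarith)) hsΛ (by rwa [add_sub_cancel])
        rw [add_sub_cancel] at hA₂
        have : s k + D (k + 1) + (e (k + 1) - s k) = e (k + 1) + D (k + 1) := by ring
        rw [this] at hR₂
        refine ⟨_, _, ?_, hR₂, hA₂⟩
        rw [add_right_comm]
        exact add_le_add_left hcost _
  obtain ⟨A, c, hc, hR, hA⟩ := key m le_rfl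
  rw [hem] at hA hR
  refine ⟨A, _, _, c, hc.trans ?_, le_add_of_nonneg_right (hD0 m), hR, hA⟩
  gcongr
  refine le_trans ?_ hηζ.le
  exact mul_le_mul_left (ENNReal.ofReal_le_ofReal (add_le_add (hWm m le_rfl) (hDm m le_rfl))) _

/-- A chain near `φ` costs more than `c₁ > c` by definition of the relaxation, yet at most `c₁ - c`
more than the decay rate of tubes around `φ`. That rate thus exceeds `c`, and a small Skorohod ball
lies in such a tube. -/
theorem exists_expUpper_eball {M : MarkovProcess S Ω} {L : Finset (Fin N) → RN N → ℝ≥0∞}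
    (hconvex : ConvexOn ℝ≥0 Set.univ (L Finset.univ)) (hA2 : AssumptionA2 L)
    (hA3 : M.AssumptionA3 L) (hT : 0 < T) {φ : PathSpace T N}
    (hφ : AbsolutelyContinuousOnInterval φ.ext 0 T) {c : ℝ}
    (hc : (c : EReal) < (rateI L T φ : EReal)) (x : RN N) :
    ∃ δ > 0, M.ExpUpper x (fun n => {ω | M.scaledPath n T ω ∈ Metric.eball φ δ}) c := by
  rcases lt_or_ge c 0 with hc0 | hc0
  · exact ⟨1, one_pos, 1, one_pos,
      Eventually.of_forall fun n z _ => M.scaledLaw_le_of_nonpos z _ hc0.le⟩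
  have hc' : ENNReal.ofReal c < rateI L T φ := by
    rwa [← EReal.coe_ennreal_lt_coe_ennreal_iff, EReal.coe_ennreal_ofReal, max_eq_left hc0]
  obtain ⟨c₁, hcc₁, hc₁⟩ := exists_between hc'
  obtain ⟨R, hR, hJ⟩ := exists_forall_lt_actionJ_of_lt_rateI hc₁
  obtain ⟨r, hr, C, hC⟩ := hA2.exists_bound hconvex
  have hcont : Continuous φ.toFun := PathSpace.continuous_toFun_iff.2 (by
    have := hφ.continuousOn
    rwa [Set.uIcc_of_le hT.le] at this)
  obtain ⟨g, hgu, hg⟩ := PathSpace.exists_uniformContinuous_extension hT.le hcont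
  have hac : AbsolutelyContinuousOnInterval g 0 T := by
    rw [absolutelyContinuousOnInterval_iff] at hφ ⊢
    intro ε hε
    obtain ⟨δ, hδ, h⟩ := hφ ε hε
    refine ⟨δ, hδ, fun E hE hEδ => (le_of_eq (Finset.sum_congr rfl fun i hi => ?_)).trans_lt
      (h E hE hEδ)⟩
    have := hE.1 i hi
    rw [Set.uIcc_of_le hT.le] at this
    rw [hg _ this.1, hg _ this.2]
  have ho : ∀ t ∈ Set.Icc 0 T, g t ∈ orthant N := fun t ht => by
    rw [hg t ht, φ.ext_apply ⟨t, ht⟩]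
    exact φ.mem_orthant _
  obtain ⟨A, τ, p, c₂, hc₂, hτ, hreach, htube⟩ := exists_reach_tubeUpper hA3 hr hC hgu hT.le ho hac
    (half_pos hR) (tsub_pos_of_lt hcc₁)
  have hcA : (c : EReal) < (A : EReal) := by
    obtain ⟨ψ, hψ, hψJ, hψφ⟩ := hreach.exists_pathSpace hT hτ
    have h1 := hJ ψ hψ ((PathSpace.edist_le_of_forall (r := ENNReal.ofReal (R / 2)) fun t => ?_).trans_lt
      ((ENNReal.ofReal_lt_ofReal_iff hR).2 (half_lt_self hR)))
    · have h2 : c₁ < A + (c₁ - ENNReal.ofReal c) := h1.trans_le (hψJ.trans hc₂)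
      have h3 : ENNReal.ofReal c < A := by
        by_contra! h3
        refine absurd h2 (not_lt.2 ?_)
        calc A + (c₁ - ENNReal.ofReal c) ≤ ENNReal.ofReal c + (c₁ - ENNReal.ofReal c) := by gcongr
          _ = c₁ := add_tsub_cancel_of_le hcc₁.le
      rwa [← EReal.coe_ennreal_lt_coe_ennreal_iff, EReal.coe_ennreal_ofReal, max_eq_left hc0] at h3
    · have := hψφ t
      rw [hg t t.2, PathSpace.ext_apply] at this
      rw [edist_comm, edist_dist, dist_eq_norm]
      exact ENNReal.ofReal_le_ofReal this
  obtain ⟨δ, hδ, H⟩ := htube c hcA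
  obtain ⟨δ', hδ', hclose⟩ := PathSpace.exists_forall_norm_sub_le hcont hδ
  refine ⟨ENNReal.ofReal δ', ENNReal.ofReal_pos.2 hδ', 1, one_pos, H.mono fun n hn z _ => ?_⟩
  refine le_trans (measure_mono ?_) (hn z)
  intro ω hω t ht0 ht
  have := hclose _ ((edist_comm _ _).trans_lt hω) ⟨t, ht0, ht⟩
  rw [zero_add, hg t ⟨ht0, ht⟩, φ.ext_apply ⟨t, ht0, ht⟩]
  exact this

/-- An upper bound with a good rate function, combined with local upper bounds, gives the global upper
bound. -/
theorem UpperLDBound.of_local {M : MarkovProcess S Ω} {I I' : PathSpace T N → ℝ≥0∞}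
    (hgood : IsGoodRateFunction I') (hupper : M.UpperLDBound T I')
    (hlocal : ∀ φ : PathSpace T N, AbsolutelyContinuousOnInterval φ.ext 0 T → ∀ c : ℝ,
      (c : EReal) < (I φ : EReal) →
        ∃ δ > 0, M.ExpUpper (φ.ext 0) (fun n => {ω | M.scaledPath n T ω ∈ Metric.eball φ δ}) c) :
    M.UpperLDBound T I := by
  refine upperLDBound_of_expUpper fun x hx F hF c hc => ?_
  obtain ⟨d, hcd, hd⟩ := EReal.lt_iff_exists_real_btwn.1 hc
  rw [EReal.coe_lt_coe_iff] at hcd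
  -- Paths with `I'` above this level are negligible at rate `d`; the rest form a compact set,
  -- covered by finitely many local balls.
  let a : ℝ≥0 := (max d 0).toNNReal + 1
  have hda : d < a := by
    have : (a : ℝ) = max d 0 + 1 := by
      simp [a, Real.coe_toNNReal _ (le_max_right d 0)]
    linarith [le_max_left d 0]
  have hK : IsCompact ({φ : PathSpace T N | φ.ext 0 ∈ ({x} : Set (RN N)) ∧ I' φ ≤ a} ∩ F) :=
    (hgood.isCompact_level {x} (by simpa using hx) isCompact_singleton a (by positivity)).inter_right
      hF
  have hloc : ∀ φ ∈ {φ : PathSpace T N | φ.ext 0 ∈ ({x} : Set (RN N)) ∧ I' φ ≤ a} ∩ F,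
      ∃ δ > 0, M.ExpUpper x (fun n => {ω | M.scaledPath n T ω ∈ Metric.eball φ δ}) d := by
    rintro φ ⟨⟨hφ0, hφI⟩, hφF⟩
    have hφ0 : φ.ext 0 = x := hφ0
    have h1 : (d : EReal) < (I φ : EReal) := by
      refine hd.trans_le (EReal.coe_ennreal_le_coe_ennreal_iff.2 ?_)
      exact iInf_le_of_le φ (iInf₂_le hφF hφ0)
    have := hlocal φ (hgood.absolutelyContinuous φ (hφI.trans_lt ENNReal.coe_lt_top)) d h1
    rwa [hφ0] at this
  choose! δ hδ hδU using hloc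
  obtain ⟨t, htK, htcov⟩ := hK.elim_nhds_subcover (fun φ => Metric.eball φ (δ φ))
    fun φ hφ => Metric.eball_mem_nhds φ (hδ φ hφ)
  have hrest : M.ExpUpper x
      (fun n => {ω | M.scaledPath n T ω ∈ F \ ⋃ φ ∈ t, Metric.eball φ (δ φ)}) d := by
    refine hupper.expUpper hx (hF.sdiff (isOpen_biUnion fun φ _ => Metric.isOpen_eball)) ?_
    have h1 : (a : ℝ≥0∞) ≤ ⨅ (φ : PathSpace T N) (_ : φ ∈ F \ ⋃ φ ∈ t, Metric.eball φ (δ φ))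
        (_ : φ.ext 0 = x), I' φ := by
      refine le_iInf fun φ => le_iInf₂ fun hφ hφ0 => ?_
      by_contra! hlt
      exact hφ.2 (htcov ⟨⟨hφ0, hlt.le⟩, hφ.1⟩)
    refine lt_of_lt_of_le ?_ (EReal.coe_ennreal_le_coe_ennreal_iff.2 h1)
    rwa [EReal.coe_nnreal_eq_coe_real, EReal.coe_lt_coe_iff]
  classical
  -- The index `none` stands for the part of `F` outside the balls.
  have hall := expUpper_biUnion (M := M) (x := x) (insert none (t.image some))
    (A := fun o n => o.elim {ω | M.scaledPath n T ω ∈ F \ ⋃ φ ∈ t, Metric.eball φ (δ φ)}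
      fun φ => {ω | M.scaledPath n T ω ∈ Metric.eball φ (δ φ)}) hcd (by
    intro o ho
    rcases Finset.mem_insert.1 ho with rfl | ho
    · exact hrest
    · obtain ⟨φ, hφ, rfl⟩ := Finset.mem_image.1 ho
      exact hδU φ (htK φ hφ))
  refine hall.mono (fun n ω hω => ?_) le_rfl
  simp only [Finset.set_biUnion_insert, Set.mem_union, Set.mem_iUnion]
  by_cases h : M.scaledPath n T ω ∈ ⋃ φ ∈ t, Metric.eball φ (δ φ)
  · obtain ⟨φ, hφ, hφ'⟩ := Set.mem_iUnion₂.1 h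
    exact Or.inr ⟨some φ, Finset.mem_image_of_mem _ hφ, hφ'⟩
  · exact Or.inl ⟨hω, h⟩

end MarkovProcess

theorem theorem2 {N : ℕ} {S : Set (RN N)} {Ω : Type*} [MeasurableSpace Ω]
    (M : MarkovProcess S Ω)
    (hdense : ∀ x ∈ orthant N, ∃ u : ℕ → RN N,
      (∀ n, 1 ≤ n → u n ∈ scaledStates S n) ∧ Tendsto u atTop (𝓝 x))
    (L : Finset (Fin N) → RN N → ℝ≥0∞)
    (hconvex : ∀ Λ, ConvexOn ℝ≥0 Set.univ (L Λ))
    (hA1 : M.AssumptionA1 L) (hA2 : AssumptionA2 L) (hA3 : M.AssumptionA3 L)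
    (T : ℝ) (hT : 0 < T)
    (hgood : ∃ I' : PathSpace T N → ℝ≥0∞, IsGoodRateFunction I' ∧ M.UpperLDBound T I') :
    M.SamplePathLDP T (rateI L T) ∧ IsGoodRateFunction (rateI L T) := by
  obtain ⟨I', hI', hupper⟩ := hgood
  have hlow : ∀ O : Set (PathSpace T N), IsOpen O → ∀ φ ∈ O, ∀ c : ℝ,
      rateI L T φ < ENNReal.ofReal c →
        M.ExpLower (φ.ext 0) (fun n => {ω | M.scaledPath n T ω ∈ O}) c :=
    fun O hO φ hφ c hc => MarkovProcess.expLower_of_rateI_lt (hconvex _) hA1 hA2 hT hO hφ hc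
  have hlsc := lowerSemicontinuous_rateI L T
  exact ⟨⟨hlsc, MarkovProcess.lowerLDBound_of_expLower hlow,
    MarkovProcess.UpperLDBound.of_local hI' hupper fun φ hφ c hc =>
      MarkovProcess.exists_expUpper_eball (hconvex _) hA2 hA3 hT hφ hc _⟩,
    .of_lower hT.le hdense hI' hupper hlsc hlow⟩
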